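/- Let $\mathbb R^3_1$ be Minkowski 3-space, i.e. $\mathbb R^3$ with $\langle u,v\rangle=u_0v_0+u_1v_1-u_2v_2$. For a map $x(u,v)$ into $\mathbb R^3_1$ put $E=\langle x_u,x_u\rangle$, $F=\langle x_u,x_v\rangle$, $G=\langle x_v,x_v\rangle$, $\bar l=\langle x_u\times x_v,x_{uu}\rangle$, $\bar m=\langle x_u\times x_v,x_{uv}\rangle$, $\bar n=\langle x_u\times x_v,x_{vv}\rangle$ (with $\times$ the Lorentzian vector product, $\langle a\times b,c\rangle=\det(a,b,c)$) and $\bar K=\bar l\bar n-\bar m^2$. If $x$ is a local parametrization of a surface $M$, the parabolic curve ($PC$) of $M$ is $\{\bar K=0\}$, and the Lorentzian region of $M$ is $\{F^2-EG>0\}$. A point of the Lorentzian region is a flat umbilic point if the second fundamental form is there a multiple of the first and $\bar K=0$ there. Let $\mathcal G$ be the set of germs $(M,p)$ of smooth surfaces in $\mathbb R^3_1$, identified with the germs of local parametrizations $(\mathbb R^2,0)\to(\mathbb R^3_1,p)$, $p\in\mathbb R^3_1$, modulo $\mathcal R$-equivalence (composition on the right with germs of diffeomorphisms of $(\mathbb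 R^2,0)$). It carries the quotient of the Whitney $C^\infty$ topology on germs, which is the coarsest topology for which all $k$-jets at $0$ are continuous. A property is generic in a set $Y$ if it holds on an open and dense subset of $Y$ in the induced topology. Let $\mathcal G_5\subset\mathcal G$ be the set of $(M,p)$ such that $p$ is in the Lorentzian region and is a singular point of the $PC$ (i.e. $\bar K=0$ and $d\bar K=0$ at $p$). A 1-parameter family of surfaces $M_t$ with $M_0=M$ is a smooth germ $(u,v,t)\mapsto x_t(u,v)$ at the origin, with $x_0=x$ a given local parametrization of $M$ at $p=x(0,0)$; the set of these families carries the Whitney topology as well. Write $\bar K_t$ for the function $\bar K$ of $x_t$. The germ $(u,v,t)\mapsto\bar K_t(u,v)$ is an $\mathcal R$-versal deformation of $\bar K_0$ if every smooth deformation $\Phi(q,s)$, $s\in(\mathbb R^m,0)$, $m\ge0$, of the germ $\Phi(q,0)=\bar K_0(q)$ satisfies $\Phi(q,s)=\bar K_{\theta(s)}(g(q,s))$ for some smooth germs $g,\theta$ with $g(q,0)=q$, $\theta(0)=0$. **Theorem.** For a generic $(M,p)\in\mathcal G_5$ the following hold for every local parametrization $x$ of $M$ at $p=x(0,0)$. (1)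 The $PC$ has an $A_1$-singularity at $p$: the germ of $\bar K$ at $0$ is $\mathcal R$-equivalent to $\pm(u^2\pm v^2)$. (2) If $p$ is not a flat umbilic point, then in generic 1-parameter families $M_t$ with $M_0=M$ the $A_1$-singularity of the $PC$ is $\mathcal R$-versally deformed: the set of families for which $\bar K_t$ is an $\mathcal R$-versal deformation of $\bar K_0$ is open and dense in the space of all families with $x_0=x$. -/

import Mathlib

open Set Filter Topology
open scoped ContDiff

namespace Minkowski

/-! Germs are handled through representatives.  Every predicate and every topology below depends
only on the germ of the maps involved. -/

section Germs

variable {E F : Type*} [NormedAddCommGroup E] [NormedSpace ℝ E]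
  [NormedAddCommGroup F] [NormedSpace ℝ F]

/-- `f` is `C^∞` on some neighbourhood of `a`, that is, `f` represents a smooth germ at `a`.
(`ContDiffAt ℝ ∞ f a` alone allows a neighbourhood that shrinks with the order.) -/
def SmoothNear (f : E → F) (a : E) : Prop :=
  ∀ᶠ y in 𝓝 a, ContDiffAt ℝ ∞ f y

/-- `h` represents a germ of a diffeomorphism `(E, 0) → (E, 0)`. -/
def IsDiffeoGerm (h : E → E) : Prop :=
  h 0 = 0 ∧ SmoothNear h 0 ∧
    ∃ k : E → E, k 0 = 0 ∧ SmoothNear k 0 ∧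
      (∀ᶠ y in 𝓝 (0 : E), k (h y) = y) ∧ ∀ᶠ y in 𝓝 (0 : E), h (k y) = y

/-- `𝓡`-equivalence of germs at the origin: `f₂ ∘ h = f₁`, that is `f₂ = f₁ ∘ h⁻¹`, for a germ
of a diffeomorphism `h`. -/
def REquiv {Y : Type*} (f₁ f₂ : E → Y) : Prop :=
  ∃ h : E → E, IsDiffeoGerm h ∧ ∀ᶠ y in 𝓝 (0 : E), f₂ (h y) = f₁ y

theorem SmoothNear.tendsto {f : E → E} (hf : SmoothNear f 0) (h0 : f 0 = 0) :
    Tendsto f (𝓝 0) (𝓝 0) := by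
  have h : ContinuousAt f 0 := (Eventually.self_of_nhds hf).continuousAt
  simpa [ContinuousAt, h0] using h

theorem SmoothNear.comp_self {f g : E → E} (hg : SmoothNear g 0) (hf : SmoothNear f 0)
    (h0 : f 0 = 0) : SmoothNear (fun y => g (f y)) 0 := by
  have h1 := (hf.tendsto h0).eventually hg
  filter_upwards [h1, hf] with y hy1 hy2
  exact hy1.comp y hy2

theorem REquiv.refl {Y : Type*} (f : E → Y) : REquiv f f := by
  have hs : SmoothNear (fun y : E => y) 0 := Eventually.of_forall fun y => contDiffAt_id
  exact ⟨fun y => y, ⟨rfl, hs, fun y => y, rfl, hs, by simp, by simp⟩, by simp⟩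

theorem REquiv.symm {Y : Type*} {f₁ f₂ : E → Y} (h : REquiv f₁ f₂) : REquiv f₂ f₁ := by
  obtain ⟨h, ⟨h0, hh, k, k0, hk, hkh, hhk⟩, he⟩ := h
  refine ⟨k, ⟨k0, hk, h, h0, hh, hhk, hkh⟩, ?_⟩
  filter_upwards [(hk.tendsto k0).eventually he, hhk] with y hy1 hy2
  rw [← hy1, hy2]

theorem REquiv.trans {Y : Type*} {f₁ f₂ f₃ : E → Y} (h : REquiv f₁ f₂) (h' : REquiv f₂ f₃) :
    REquiv f₁ f₃ := by
  obtain ⟨h, ⟨h0, hh, k, k0, hk, hkh, hhk⟩, he⟩ := h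
  obtain ⟨h', ⟨h0', hh', k', k0', hk', hkh', hhk'⟩, he'⟩ := h'
  refine ⟨fun y => h' (h y), ⟨by simp [h0, h0'], hh'.comp_self hh h0, fun y => k (k' y),
    by simp [k0, k0'], hk.comp_self hk' k0', ?_, ?_⟩, ?_⟩
  · filter_upwards [(hh.tendsto h0).eventually hkh', hkh] with y hy1 hy2
    rw [hy1, hy2]
  · filter_upwards [(hk'.tendsto k0').eventually hhk, hhk'] with y hy1 hy2
    rw [hy1, hy2]
  · filter_upwards [(hh.tendsto h0).eventually he', he] with y hy1 hy2
    rw [hy1, hy2]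

end Germs

/-- An `A₁`-singularity: the germ at the origin is `𝓡`-equivalent to `±(x² ± y²)`. -/
def HasA1 (f : ℝ × ℝ → ℝ) : Prop :=
  ∃ a b : ℝ, (a = 1 ∨ a = -1) ∧ (b = 1 ∨ b = -1) ∧
    REquiv f (fun p : ℝ × ℝ => a * (p.1 ^ 2 + b * p.2 ^ 2))

/-- `K`, a smooth germ at the origin of functions of `(p, t)`, is an `𝓡`-versal (one-parameter)
deformation of the germ `p ↦ K (p, 0)`: every deformation `G` of this germ, with any number `m`
of parameters, is induced from `K`, that is `G (p, s) = K (g (p, s), θ s)` with `g` and `θ`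
smooth, `g (p, 0) = p` and `θ 0 = 0`. -/
def IsRVersal (K : (ℝ × ℝ) × ℝ → ℝ) : Prop :=
  SmoothNear K 0 ∧
    ∀ (m : ℕ) (G : (ℝ × ℝ) × (Fin m → ℝ) → ℝ), SmoothNear G 0 →
      (∀ᶠ p in 𝓝 (0 : ℝ × ℝ), G (p, 0) = K (p, 0)) →
        ∃ (g : (ℝ × ℝ) × (Fin m → ℝ) → ℝ × ℝ) (θ : (Fin m → ℝ) → ℝ),
          SmoothNear g 0 ∧ SmoothNear θ 0 ∧ θ 0 = 0 ∧
          (∀ᶠ p in 𝓝 (0 : ℝ × ℝ), g (p, 0) = p) ∧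
          ∀ᶠ q in 𝓝 (0 : (ℝ × ℝ) × (Fin m → ℝ)), G q = K (g q, θ q.2)

/-- A property (given as a set `P`) is generic in `Y` if it holds on an open and dense subset of
`Y`, for the induced topology on `Y`. -/
def GenericIn {X : Type*} [TopologicalSpace X] (Y P : Set X) : Prop :=
  IsOpen (((↑) : Y → X) ⁻¹' P) ∧ Dense (((↑) : Y → X) ⁻¹' P)

section Geometry

/-- The pseudo-scalar product `u₀v₀ + u₁v₁ - u₂v₂` of Minkowski 3-space. -/
def mink (a b : Fin 3 → ℝ) : ℝ := a 0 * b 0 + a 1 * b 1 - a 2 * b 2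

/-- The Lorentzian vector product, see `mink_lcross`. -/
def lcross (a b : Fin 3 → ℝ) : Fin 3 → ℝ :=
  ![a 1 * b 2 - a 2 * b 1, a 2 * b 0 - a 0 * b 2, -(a 0 * b 1 - a 1 * b 0)]

theorem mink_lcross (a b c : Fin 3 → ℝ) : mink (lcross a b) c = (Matrix.of ![a, b, c]).det := by
  simp [mink, lcross, Matrix.det_fin_three]
  ring

variable (x : ℝ × ℝ → Fin 3 → ℝ)

/-- The partial derivative `∂x/∂u`. -/
noncomputable def pu (p : ℝ × ℝ) : Fin 3 → ℝ := fderiv ℝ x p (1, 0)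

/-- The partial derivative `∂x/∂v`. -/
noncomputable def pv (p : ℝ × ℝ) : Fin 3 → ℝ := fderiv ℝ x p (0, 1)

/-- First fundamental form, coefficient `E`. -/
noncomputable def coeffE (p : ℝ × ℝ) : ℝ := mink (pu x p) (pu x p)

/-- First fundamental form, coefficient `F`. -/
noncomputable def coeffF (p : ℝ × ℝ) : ℝ := mink (pu x p) (pv x p)

/-- First fundamental form, coefficient `G`. -/
noncomputable def coeffG (p : ℝ × ℝ) : ℝ := mink (pv x p) (pv x p)

/-- `δ = F² - EG`; the induced metric is Lorentzian where `δ > 0`. -/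
noncomputable def delta (p : ℝ × ℝ) : ℝ := coeffF x p ^ 2 - coeffE x p * coeffG x p

/-- `⟨x_u × x_v, x_uu⟩`. -/
noncomputable def lbar (p : ℝ × ℝ) : ℝ := mink (lcross (pu x p) (pv x p)) (pu (pu x) p)

/-- `⟨x_u × x_v, x_uv⟩`. -/
noncomputable def mbar (p : ℝ × ℝ) : ℝ := mink (lcross (pu x p) (pv x p)) (pv (pu x) p)

/-- `⟨x_u × x_v, x_vv⟩`. -/
noncomputable def nbar (p : ℝ × ℝ) : ℝ := mink (lcross (pu x p) (pv x p)) (pv (pv x) p)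

/-- `l̄ n̄ - m̄²`, whose zero set is the parabolic curve. -/
noncomputable def Kbar (p : ℝ × ℝ) : ℝ := lbar x p * nbar x p - mbar x p ^ 2

/-- The point of parameter `p` is a singular point of the parabolic curve `K̄ = 0`. -/
def IsSingularPC (p : ℝ × ℝ) : Prop := Kbar x p = 0 ∧ fderiv ℝ (Kbar x) p = 0

/-- Umbilic point (of a nondegenerate surface): the second fundamental form is a multiple of the
first one, that is, the shape operator is a multiple of the identity. -/
def IsUmbilic (p : ℝ × ℝ) : Prop :=
  ∃ c : ℝ, lbar x p = c * coeffE x p ∧ mbar x p = c * coeffF x p ∧ nbar x p = c * coeffG x p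

/-- Flat umbilic point: an umbilic point where the Gaussian curvature is zero. -/
def IsFlatUmbilic (p : ℝ × ℝ) : Prop := IsUmbilic x p ∧ Kbar x p = 0

end Geometry

/-- (A representative of) a germ at the origin of a local parametrization of a surface. An immersion
is locally an embedding, so the continuity of the inverse is automatic. -/
structure ParamGerm where
  toFun : ℝ × ℝ → Fin 3 → ℝ
  smooth : SmoothNear toFun 0
  immersion : Function.Injective (fderiv ℝ toFun 0)

/-- The Whitney `C^∞` topology on germs at a point: the coarsest one for which all the `k`-jets at
the point are continuous. -/
noncomputable instance : TopologicalSpace ParamGerm :=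
  TopologicalSpace.induced (fun (x : ParamGerm) (k : ℕ) => iteratedFDeriv ℝ k x.toFun 0)
    inferInstance

/-- `𝓡`-equivalence of parametrizations. It identifies in particular representatives of the
same germ. -/
instance ParamGerm.rSetoid : Setoid ParamGerm where
  r x y := REquiv x.toFun y.toFun
  iseqv := ⟨fun x => REquiv.refl x.toFun, fun h => h.symm, fun h h' => h.trans h'⟩

/-- Germs `(M, p)` of smooth surfaces in Minkowski 3-space: germs of local parametrizations up to
`𝓡`-equivalence, with the quotient topology. -/
abbrev SurfaceGerm : Type := Quotient ParamGerm.rSetoid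

/-- `x` is a local parametrization of the surface germ `S`. -/
def Parametrizes (x : ParamGerm) (S : SurfaceGerm) : Prop := Quotient.mk ParamGerm.rSetoid x = S

/-- The germs `(M, p)` such that `p` is a singular point of the parabolic curve in the Lorentzian
region. -/
def singularPCGerms : Set SurfaceGerm :=
  {S | ∃ x : ParamGerm, Parametrizes x S ∧ 0 < delta x.toFun 0 ∧ IsSingularPC x.toFun 0}

/-- (A representative of) a 1-parameter family `M_t` of surfaces with `M_0 = M`, where `M` is
parametrized by `x`: a family of maps `x_t` depending smoothly on `t ∈ (ℝ, 0)` with `x_0 = x`.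
The map sends `(p, t)` to `x_t p`. -/
structure SurfaceFamily (x : ParamGerm) where
  toFun : (ℝ × ℝ) × ℝ → Fin 3 → ℝ
  smooth : SmoothNear toFun 0
  initial : ∀ᶠ p in 𝓝 (0 : ℝ × ℝ), toFun (p, 0) = x.toFun p

/-- The Whitney `C^∞` topology on germs of families. -/
noncomputable instance (x : ParamGerm) : TopologicalSpace (SurfaceFamily x) :=
  TopologicalSpace.induced (fun (X : SurfaceFamily x) (k : ℕ) => iteratedFDeriv ℝ k X.toFun 0)
    inferInstance

/-- The function `K̄_t`, as a function of `(p, t)`, whose zero sets are the parabolic curves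
of the surfaces `M_t`. -/
noncomputable def SurfaceFamily.Kbar {x : ParamGerm} (X : SurfaceFamily x) :
    (ℝ × ℝ) × ℝ → ℝ :=
  fun q => Minkowski.Kbar (fun p => X.toFun (p, q.2)) q.1

end Minkowski

open Minkowski

namespace Minkowski

section SmoothGerms

variable {E F G : Type*} [NormedAddCommGroup E] [NormedSpace ℝ E]
  [NormedAddCommGroup F] [NormedSpace ℝ F] [NormedAddCommGroup G] [NormedSpace ℝ G]

theorem SmoothNear.contDiffAt {f : E → F} {a : E} (h : SmoothNear f a) : ContDiffAt ℝ ∞ f a :=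
  Eventually.self_of_nhds h

theorem SmoothNear.continuousAt {f : E → F} {a : E} (h : SmoothNear f a) : ContinuousAt f a :=
  h.contDiffAt.continuousAt

theorem SmoothNear.differentiableAt {f : E → F} {a : E} (h : SmoothNear f a) :
    DifferentiableAt ℝ f a :=
  h.contDiffAt.differentiableAt (by simp)

theorem SmoothNear.eventually_smoothNear {f : E → F} {a : E} (h : SmoothNear f a) :
    ∀ᶠ y in 𝓝 a, SmoothNear f y :=
  eventually_eventually_nhds.2 h

theorem ContDiff.smoothNear {f : E → F} (h : ContDiff ℝ ∞ f) (a : E) : SmoothNear f a :=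
  Eventually.of_forall fun _ => h.contDiffAt

theorem SmoothNear.congr {f g : E → F} {a : E} (h : SmoothNear f a) (hg : g =ᶠ[𝓝 a] f) :
    SmoothNear g a := by
  filter_upwards [h, hg.eventuallyEq_nhds] with y hy hy'
  exact hy.congr_of_eventuallyEq hy'

theorem SmoothNear.comp {g : F → G} {f : E → F} {a : E} (hg : SmoothNear g (f a))
    (hf : SmoothNear f a) : SmoothNear (fun y => g (f y)) a := by
  filter_upwards [hf.continuousAt.eventually hg, hf] with y h1 h2
  exact h1.comp y h2

theorem SmoothNear.comp_of_eq {g : F → G} {f : E → F} {a : E} {b : F} (hg : SmoothNear g b)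
    (hf : SmoothNear f a) (hb : f a = b) : SmoothNear (fun y => g (f y)) a := by
  subst hb; exact hg.comp hf

theorem SmoothNear.prodMk {f : E → F} {g : E → G} {a : E} (hf : SmoothNear f a)
    (hg : SmoothNear g a) : SmoothNear (fun y => (f y, g y)) a := by
  filter_upwards [hf, hg] with y h1 h2 using h1.prodMk h2

theorem SmoothNear.fst {f : E → F × G} {a : E} (hf : SmoothNear f a) :
    SmoothNear (fun y => (f y).1) a := by
  filter_upwards [hf] with y h1 using h1.fst

theorem SmoothNear.snd {f : E → F × G} {a : E} (hf : SmoothNear f a) :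
    SmoothNear (fun y => (f y).2) a := by
  filter_upwards [hf] with y h1 using h1.snd

theorem smoothNear_const (c : F) (a : E) : SmoothNear (fun _ : E => c) a :=
  Eventually.of_forall fun _ => contDiffAt_const

theorem smoothNear_id (a : E) : SmoothNear (fun y : E => y) a :=
  Eventually.of_forall fun _ => contDiffAt_id

theorem SmoothNear.add {f g : E → F} {a : E} (hf : SmoothNear f a) (hg : SmoothNear g a) :
    SmoothNear (fun y => f y + g y) a := by
  filter_upwards [hf, hg] with y h1 h2 using h1.add h2

theorem SmoothNear.sub {f g : E → F} {a : E} (hf : SmoothNear f a) (hg : SmoothNear g a) :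
    SmoothNear (fun y => f y - g y) a := by
  filter_upwards [hf, hg] with y h1 h2 using h1.sub h2

theorem SmoothNear.mul {f g : E → ℝ} {a : E} (hf : SmoothNear f a) (hg : SmoothNear g a) :
    SmoothNear (fun y => f y * g y) a := by
  filter_upwards [hf, hg] with y h1 h2 using h1.mul h2

theorem SmoothNear.pow {f : E → ℝ} {a : E} (hf : SmoothNear f a) (n : ℕ) :
    SmoothNear (fun y => f y ^ n) a := by
  filter_upwards [hf] with y h1 using h1.pow n

theorem SmoothNear.fderiv_apply {f : E → F} {a : E} (hf : SmoothNear f a) (v : E) :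
    SmoothNear (fun y => fderiv ℝ f y v) a := by
  filter_upwards [hf] with y h1
  exact (h1.fderiv_right (m := ∞) (by simp)).clm_apply contDiffAt_const

/-- A smooth germ has a globally smooth representative. -/
theorem SmoothNear.exists_contDiff [FiniteDimensional ℝ E] {f : E → F} {a : E}
    (hf : SmoothNear f a) : ∃ g : E → F, ContDiff ℝ ∞ g ∧ g =ᶠ[𝓝 a] f := by
  obtain ⟨r, hr, hball⟩ := Metric.eventually_nhds_iff_ball.1 hf
  let χ : ContDiffBump a := ⟨r / 4, r / 2, by positivity, by linarith⟩
  refine ⟨fun y => χ y • f y, ?_, ?_⟩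
  · rw [contDiff_iff_contDiffAt]
    intro y
    by_cases hy : y ∈ Metric.ball a r
    · exact χ.contDiffAt.smul (hball y hy)
    · have : (fun y => χ y • f y) =ᶠ[𝓝 y] fun _ => 0 := by
        have hopen : (Metric.closedBall a (r / 2))ᶜ ∈ 𝓝 y := by
          apply Metric.isClosed_closedBall.isOpen_compl.mem_nhds
          simp only [Metric.mem_ball, not_lt, mem_compl_iff, Metric.mem_closedBall, not_le] at hy ⊢
          linarith
        filter_upwards [hopen] with z hz
        have : χ z = 0 := χ.zero_of_le_dist (by
          simp only [mem_compl_iff, Metric.mem_closedBall, not_le] at hz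
          exact hz.le)
        simp [this]
      exact contDiffAt_const.congr_of_eventuallyEq this
  · filter_upwards [χ.eventuallyEq_one] with z hz
    simp [hz]

/-- The inverse function theorem for smooth germs. -/
theorem SmoothNear.exists_inverse [CompleteSpace E] {f : E → F} (hf : SmoothNear f 0)
    (h0 : f 0 = 0) (e : E ≃L[ℝ] F) (he : fderiv ℝ f 0 = e) :
    ∃ k : F → E, SmoothNear k 0 ∧ k 0 = 0 ∧ (∀ᶠ y in 𝓝 0, k (f y) = y) ∧
      ∀ᶠ y in 𝓝 0, f (k y) = y := by
  have hd : HasFDerivAt f (e : E →L[ℝ] F) 0 := he ▸ hf.differentiableAt.hasFDerivAt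
  let Φ := hf.contDiffAt.toOpenPartialHomeomorph f hd (by simp)
  have hs : (0 : E) ∈ Φ.source := hf.contDiffAt.mem_toOpenPartialHomeomorph_source hd (by simp)
  have hΦ : ∀ y, Φ y = f y := fun _ => rfl
  have ht : (0 : F) ∈ Φ.target := by
    have := Φ.map_source hs
    rwa [hΦ, h0] at this
  have hk0 : Φ.symm 0 = 0 := by
    have := Φ.left_inv hs
    rwa [hΦ, h0] at this
  have hcont : ContinuousAt Φ.symm 0 := Φ.continuousAt_symm ht
  have hcont' : Tendsto Φ.symm (𝓝 0) (𝓝 0) := by simpa [ContinuousAt, hk0] using hcont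
  refine ⟨Φ.symm, ?_, hk0, ?_, ?_⟩
  · have hinv : ∀ᶠ y in 𝓝 (0 : E), fderiv ℝ f y ∈
        range (ContinuousLinearEquiv.toContinuousLinearMap : (E ≃L[ℝ] F) → E →L[ℝ] F) := by
      have hc : ContinuousAt (fderiv ℝ f) 0 :=
        (hf.contDiffAt.fderiv_right (m := ∞) (by simp)).continuousAt
      exact hc.eventually (by rw [he]; exact e.nhds)
    filter_upwards [hcont'.eventually hinv, hcont'.eventually hf, Φ.open_target.mem_nhds ht]
      with y ⟨e', he'⟩ h2 h3
    refine Φ.contDiffAt_symm (f₀' := e') h3 ?_ h2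
    rw [he']
    exact (h2.differentiableAt (by simp)).hasFDerivAt
  · filter_upwards [Φ.open_source.mem_nhds hs] with y hy using Φ.left_inv hy
  · filter_upwards [Φ.open_target.mem_nhds ht] with y hy using Φ.right_inv hy

/-- The implicit function theorem for smooth germs. -/
theorem SmoothNear.exists_implicit [FiniteDimensional ℝ E] [FiniteDimensional ℝ G]
    {H : E × G → E} (hH : SmoothNear H 0) (h0 : H 0 = 0)
    (hinj : ∀ y, fderiv ℝ H 0 (y, 0) = 0 → y = 0) :
    ∃ φ : G → E, SmoothNear φ 0 ∧ φ 0 = 0 ∧ (∀ᶠ w in 𝓝 0, H (φ w, w) = 0) ∧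
      ∀ᶠ q in 𝓝 (0 : E × G), H q = 0 → q.1 = φ q.2 := by
  let f : E × G → E × G := fun q => (H q, q.2)
  have hf : SmoothNear f 0 := hH.prodMk (smoothNear_id _).snd
  have hf0 : f 0 = 0 := by simp [f, h0]
  have hd : HasFDerivAt f ((fderiv ℝ H 0).prod (ContinuousLinearMap.snd ℝ E G)) 0 :=
    hH.differentiableAt.hasFDerivAt.prodMk hasFDerivAt_snd
  have hi : Function.Injective
      (((fderiv ℝ H 0).prod (ContinuousLinearMap.snd ℝ E G)).toLinearMap) := by
    rw [injective_iff_map_eq_zero]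
    rintro ⟨y, w⟩ h
    simp only [ContinuousLinearMap.coe_coe, ContinuousLinearMap.prod_apply,
      ContinuousLinearMap.coe_snd', Prod.mk_eq_zero] at h
    obtain ⟨h1, rfl⟩ := h
    rw [hinj y h1]; rfl
  let e := (LinearEquiv.ofInjectiveEndo _ hi).toContinuousLinearEquiv
  have he : fderiv ℝ f 0 = e := by
    rw [hd.fderiv]; ext q <;> rfl
  obtain ⟨k, hk, hk0, hkf, hfk⟩ := hf.exists_inverse hf0 e he
  have hι : SmoothNear (fun w : G => ((0 : E), w)) 0 :=
    (smoothNear_const _ _).prodMk (smoothNear_id _)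
  have hιt : Tendsto (fun w : G => ((0 : E), w)) (𝓝 0) (𝓝 0) := by
    exact hι.continuousAt
  refine ⟨fun w => (k (0, w)).1, (hk.comp_of_eq hι rfl).fst, ?_, ?_, ?_⟩
  · change (k 0).1 = 0
    rw [hk0]; rfl
  · filter_upwards [hιt.eventually hfk] with w hw
    have h2 : (k (0, w)).2 = w := congrArg Prod.snd hw
    have h1 : H (k (0, w)) = 0 := congrArg Prod.fst hw
    calc H ((k (0, w)).1, w) = H ((k (0, w)).1, (k (0, w)).2) := by rw [h2]
      _ = 0 := h1
  · filter_upwards [hkf] with q hq h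
    have : f q = (0, q.2) := by simp [f, h]
    rw [this] at hq
    rw [hq]

end SmoothGerms

section Integral

theorem contDiff_nat_intervalIntegral {W : Type} [NormedAddCommGroup W] [NormedSpace ℝ W]
    [FiniteDimensional ℝ W] (n : ℕ) : ∀ {V : Type} [NormedAddCommGroup V] [NormedSpace ℝ V]
    {φ : ℝ × W → V}, ContDiff ℝ ∞ φ → ContDiff ℝ n (fun w => ∫ t in (0 : ℝ)..1, φ (t, w)) := by
  have := FiniteDimensional.proper ℝ W
  induction n with
  | zero =>
    intro V _ _ φ hφ
    refine contDiff_zero.2 ?_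
    refine intervalIntegral.continuous_parametric_intervalIntegral_of_continuous'
      (f := fun w t => φ (t, w)) ?_ 0 1
    exact hφ.continuous.comp continuous_swap
  | succ n ih =>
    intro V _ _ φ hφ
    rw [Nat.cast_succ, contDiff_succ_iff_hasFDerivAt]
    let φ' : ℝ × W → W →L[ℝ] V := fun q =>
      (fderiv ℝ φ q).comp (ContinuousLinearMap.inr ℝ ℝ W)
    have hφ' : ContDiff ℝ ∞ φ' :=
      (hφ.fderiv_right (m := ∞) (by simp)).clm_comp contDiff_const
    refine ⟨fun w => ∫ t in (0 : ℝ)..1, φ' (t, w), ih hφ', fun w => ?_⟩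
    obtain ⟨C, hC⟩ := ((isCompact_Icc (a := (0 : ℝ)) (b := 1)).prod
      (isCompact_closedBall w 1)).exists_bound_of_continuousOn hφ'.continuous.continuousOn
    have hslice : ∀ w : W, Continuous fun t : ℝ => (t, w) := fun w => by fun_prop
    refine intervalIntegral.hasFDerivAt_integral_of_dominated_of_fderiv_le
      (F := fun w t => φ (t, w)) (F' := fun w t => φ' (t, w)) (bound := fun _ => C)
      (Metric.closedBall_mem_nhds w one_pos) ?_ ?_ ?_ ?_ ?_ ?_
    · exact Eventually.of_forall fun y => (hφ.continuous.comp (hslice y)).aestronglyMeasurable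
    · exact (hφ.continuous.comp (hslice w)).intervalIntegrable _ _
    · exact (hφ'.continuous.comp (hslice w)).aestronglyMeasurable
    · refine Eventually.of_forall fun t ht y hy => hC (t, y) ⟨?_, hy⟩
      rw [uIoc_of_le zero_le_one] at ht
      exact ⟨ht.1.le, ht.2⟩
    · exact intervalIntegrable_const
    · refine Eventually.of_forall fun t _ y _ => ?_
      have h1 : HasFDerivAt φ (fderiv ℝ φ (t, y)) (t, y) :=
        (hφ.differentiable (by simp) _).hasFDerivAt
      exact h1.comp y (hasFDerivAt_prodMk_right t y)

theorem contDiff_intervalIntegral {W V : Type} [NormedAddCommGroup W] [NormedSpace ℝ W]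
    [FiniteDimensional ℝ W] [NormedAddCommGroup V] [NormedSpace ℝ V]
    {φ : ℝ × W → V} (hφ : ContDiff ℝ ∞ φ) :
    ContDiff ℝ ∞ (fun w => ∫ t in (0 : ℝ)..1, φ (t, w)) :=
  contDiff_infty.2 fun n => contDiff_nat_intervalIntegral n hφ

variable {Z : Type} [NormedAddCommGroup Z] [NormedSpace ℝ Z] [FiniteDimensional ℝ Z]

/-- Hadamard's lemma with parameters. -/
theorem SmoothNear.hadamard {f : (ℝ × ℝ) × Z → ℝ} (hf : SmoothNear f 0)
    (h0 : ∀ᶠ z in 𝓝 (0 : Z), f (0, z) = 0) :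
    ∃ a b : (ℝ × ℝ) × Z → ℝ, SmoothNear a 0 ∧ SmoothNear b 0 ∧
      ∀ᶠ q in 𝓝 0, f q = q.1.1 * a q + q.1.2 * b q := by
  obtain ⟨F, hF, hFf⟩ := hf.exists_contDiff
  have key : ∀ v : (ℝ × ℝ) × Z, ContDiff ℝ ∞
      (fun q : (ℝ × ℝ) × Z => ∫ t in (0 : ℝ)..1, fderiv ℝ F (t • q.1, q.2) v) := by
    intro v
    refine contDiff_intervalIntegral (φ := fun r : ℝ × ((ℝ × ℝ) × Z) =>
      fderiv ℝ F (r.1 • r.2.1, r.2.2) v) ?_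
    have h1 : ContDiff ℝ ∞ (fderiv ℝ F) := hF.fderiv_right (by simp)
    have h2 : ContDiff ℝ ∞ (fun r : ℝ × ((ℝ × ℝ) × Z) => (r.1 • r.2.1, r.2.2)) := by fun_prop
    exact (h1.comp h2).clm_apply contDiff_const
  refine ⟨_, _, ContDiff.smoothNear (key ((1, 0), 0)) 0, ContDiff.smoothNear (key ((0, 1), 0)) 0,
    ?_⟩
  have hz : Tendsto (fun q : (ℝ × ℝ) × Z => q.2) (𝓝 0) (𝓝 0) := by
    simpa [ContinuousAt] using (continuous_snd (X := ℝ × ℝ) (Y := Z)).continuousAt (x := 0)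
  have hιt : Tendsto (fun z : Z => ((0 : ℝ × ℝ), z)) (𝓝 0) (𝓝 0) := by
    have : Continuous (fun z : Z => ((0 : ℝ × ℝ), z)) := by fun_prop
    exact this.continuousAt (x := 0)
  filter_upwards [hFf, hz.eventually h0, hz.eventually (hιt.eventually hFf)] with q h1 h2 h3
  have hcd : Continuous (fun t : ℝ => fderiv ℝ F (t • q.1, q.2)) := by
    have h1 : ContDiff ℝ ∞ (fderiv ℝ F) := hF.fderiv_right (by simp)
    exact h1.continuous.comp (by fun_prop)
  have hder : ∀ t : ℝ, HasDerivAt (fun t : ℝ => F (t • q.1, q.2))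
      (fderiv ℝ F (t • q.1, q.2) (q.1, 0)) t := by
    intro t
    have e1 : HasDerivAt (fun t : ℝ => (t • q.1, q.2)) (q.1, (0 : Z)) t := by
      simpa using ((hasDerivAt_id t).smul_const q.1).prodMk (hasDerivAt_const t q.2)
    exact ((hF.differentiable (by simp) _).hasFDerivAt).comp_hasDerivAt t e1
  have hint := intervalIntegral.integral_eq_sub_of_hasDerivAt (a := 0) (b := 1)
    (fun t _ => hder t) ((hcd.clm_apply continuous_const).intervalIntegrable _ _)
  have hsplit : (q.1, (0 : Z)) = q.1.1 • (((1 : ℝ), (0 : ℝ)), (0 : Z)) +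
      q.1.2 • (((0 : ℝ), (1 : ℝ)), (0 : Z)) := by
    ext <;> simp
  simp only [hsplit, map_add, map_smul, smul_eq_mul] at hint
  rw [intervalIntegral.integral_add, intervalIntegral.integral_const_mul,
    intervalIntegral.integral_const_mul] at hint
  · rw [hint, ← h1]
    simp [h3, h2]
  · exact (continuous_const.mul (hcd.clm_apply continuous_const)).intervalIntegrable _ _
  · exact (continuous_const.mul (hcd.clm_apply continuous_const)).intervalIntegrable _ _

end Integral

end Minkowski

namespace Minkowski

section DirectionalDerivatives

variable {E F : Type*} [NormedAddCommGroup E] [NormedSpace ℝ E]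
  [NormedAddCommGroup F] [NormedSpace ℝ F]

/-- The derivative of `f` in the direction `v`. -/
noncomputable def dd (v : E) (f : E → F) (p : E) : F := fderiv ℝ f p v

theorem SmoothNear.along {f : E → F} {a : E} (hf : SmoothNear f a) (v : E) :
    SmoothNear (dd v f) a :=
  hf.fderiv_apply v

theorem dd_congr {f g : E → F} {a : E} (h : f =ᶠ[𝓝 a] g) (v : E) : dd v f =ᶠ[𝓝 a] dd v g := by
  filter_upwards [h.eventuallyEq_nhds] with y hy
  simp only [dd, hy.fderiv_eq]

theorem dd_congr_at {f g : E → F} {a : E} (h : f =ᶠ[𝓝 a] g) (v : E) : dd v f a = dd v g a :=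
  (dd_congr h v).eq_of_nhds

theorem dd_congr_at₂ {f g : E → F} {a : E} (h : f =ᶠ[𝓝 a] g) (v w : E) :
    dd v (dd w f) a = dd v (dd w g) a :=
  dd_congr_at (dd_congr h w) v

theorem dd_comm {f : E → F} {a : E} (hf : SmoothNear f a) (v w : E) :
    dd v (dd w f) a = dd w (dd v f) a := by
  have hs : IsSymmSndFDerivAt ℝ f a :=
    hf.contDiffAt.isSymmSndFDerivAt (by
      rw [minSmoothness_of_isRCLikeNormedField]
      exact WithTop.coe_le_coe.2 le_top)
  have hd : DifferentiableAt ℝ (fderiv ℝ f) a :=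
    (hf.contDiffAt.fderiv_right (m := ∞) (by simp)).differentiableAt (by simp)
  have key : ∀ v w : E, dd v (dd w f) a = fderiv ℝ (fderiv ℝ f) a v w := by
    intro v w
    have := (hd.hasFDerivAt.clm_apply (hasFDerivAt_const w a)).fderiv
    change fderiv ℝ (fun y => fderiv ℝ f y w) a v = _
    rw [this]
    simp
  rw [key, key, hs v w]

theorem dd_const (v : E) (c : F) (p : E) : dd v (fun _ => c) p = 0 := by
  simp [dd]

theorem dd_add_at {f g : E → F} {a : E} (hf : SmoothNear f a) (hg : SmoothNear g a) (v : E) :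
    dd v (fun p => f p + g p) a = dd v f a + dd v g a := by
  simp [dd, fderiv_fun_add hf.differentiableAt hg.differentiableAt]

theorem dd_add {f g : E → F} {a : E} (hf : SmoothNear f a) (hg : SmoothNear g a) (v : E) :
    dd v (fun p => f p + g p) =ᶠ[𝓝 a] fun p => dd v f p + dd v g p := by
  filter_upwards [hf.eventually_smoothNear, hg.eventually_smoothNear] with y h1 h2
  exact dd_add_at h1 h2 v

theorem dd_sub_at {f g : E → F} {a : E} (hf : SmoothNear f a) (hg : SmoothNear g a) (v : E) :
    dd v (fun p => f p - g p) a = dd v f a - dd v g a := by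
  simp [dd, fderiv_fun_sub hf.differentiableAt hg.differentiableAt]

theorem dd_sub {f g : E → F} {a : E} (hf : SmoothNear f a) (hg : SmoothNear g a) (v : E) :
    dd v (fun p => f p - g p) =ᶠ[𝓝 a] fun p => dd v f p - dd v g p := by
  filter_upwards [hf.eventually_smoothNear, hg.eventually_smoothNear] with y h1 h2
  exact dd_sub_at h1 h2 v

theorem dd_mul_at {f g : E → ℝ} {a : E} (hf : SmoothNear f a) (hg : SmoothNear g a) (v : E) :
    dd v (fun p => f p * g p) a = dd v f a * g a + f a * dd v g a := by
  simp [dd, fderiv_fun_mul hf.differentiableAt hg.differentiableAt]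
  ring

theorem dd_mul {f g : E → ℝ} {a : E} (hf : SmoothNear f a) (hg : SmoothNear g a) (v : E) :
    dd v (fun p => f p * g p) =ᶠ[𝓝 a] fun p => dd v f p * g p + f p * dd v g p := by
  filter_upwards [hf.eventually_smoothNear, hg.eventually_smoothNear] with y h1 h2
  exact dd_mul_at h1 h2 v

theorem dd_add_at₂ {f g : E → F} {a : E} (hf : SmoothNear f a) (hg : SmoothNear g a) (v w : E) :
    dd v (dd w fun p => f p + g p) a = dd v (dd w f) a + dd v (dd w g) a := by
  rw [dd_congr_at (dd_add hf hg w), dd_add_at (hf.along w) (hg.along w)]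

theorem dd_sub_at₂ {f g : E → F} {a : E} (hf : SmoothNear f a) (hg : SmoothNear g a) (v w : E) :
    dd v (dd w fun p => f p - g p) a = dd v (dd w f) a - dd v (dd w g) a := by
  rw [dd_congr_at (dd_sub hf hg w), dd_sub_at (hf.along w) (hg.along w)]

theorem dd_mul_at₂ {f g : E → ℝ} {a : E} (hf : SmoothNear f a) (hg : SmoothNear g a) (v w : E) :
    dd v (dd w fun p => f p * g p) a = dd v (dd w f) a * g a + dd w f a * dd v g a +
      (dd v f a * dd w g a + f a * dd v (dd w g) a) := by
  rw [dd_congr_at (dd_mul hf hg w), dd_add_at ((hf.along w).mul hg) (hf.mul (hg.along w)),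
    dd_mul_at (hf.along w) hg, dd_mul_at hf (hg.along w)]

/-- The Hessian determinant of `f` at the origin with respect to two directions. -/
noncomputable def hessDet (e₁ e₂ : E) (f : E → ℝ) : ℝ :=
  dd e₁ (dd e₁ f) 0 * dd e₂ (dd e₂ f) 0 - dd e₁ (dd e₂ f) 0 ^ 2

theorem hessDet_congr {f g : E → ℝ} (h : f =ᶠ[𝓝 0] g) (e₁ e₂ : E) :
    hessDet e₁ e₂ f = hessDet e₁ e₂ g := by
  simp only [hessDet, dd_congr_at₂ h]

theorem hessDet_mul {j f : E → ℝ} (hj : SmoothNear j 0) (hf : SmoothNear f 0) (h0 : f 0 = 0)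
    {e₁ e₂ : E} (h1 : dd e₁ f 0 = 0) (h2 : dd e₂ f 0 = 0) :
    hessDet e₁ e₂ (fun p => j p * f p) = j 0 ^ 2 * hessDet e₁ e₂ f := by
  simp only [hessDet, dd_mul_at₂ hj hf, h0, h1, h2]
  ring

end DirectionalDerivatives

section Plane

/-- The first basis vector of the parameter plane. -/
def eu : ℝ × ℝ := (1, 0)

/-- The second basis vector of the parameter plane. -/
def ev : ℝ × ℝ := (0, 1)

variable {E F : Type*} [NormedAddCommGroup E] [NormedSpace ℝ E]
  [NormedAddCommGroup F] [NormedSpace ℝ F]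

theorem fderiv_plane (f : ℝ × ℝ → F) (p v : ℝ × ℝ) :
    fderiv ℝ f p v = v.1 • dd eu f p + v.2 • dd ev f p := by
  have : v = v.1 • eu + v.2 • ev := by ext <;> simp [eu, ev]
  conv_lhs => rw [this]
  simp [dd]

theorem fderiv_plane_eq_zero_iff (f : ℝ × ℝ → F) (p : ℝ × ℝ) :
    fderiv ℝ f p = 0 ↔ dd eu f p = 0 ∧ dd ev f p = 0 := by
  constructor
  · intro h; simp [dd, h]
  · rintro ⟨h1, h2⟩
    refine ContinuousLinearMap.ext fun v => ?_
    rw [fderiv_plane, h1, h2]; simp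

theorem dd_fst {h : E → ℝ × ℝ} {p : E} (hh : SmoothNear h p) (v : E) :
    dd v (fun q => (h q).1) p = (dd v h p).1 := by
  simp only [dd]
  rw [(hh.differentiableAt.hasFDerivAt.fst).fderiv]; rfl

theorem dd_snd {h : E → ℝ × ℝ} {p : E} (hh : SmoothNear h p) (v : E) :
    dd v (fun q => (h q).2) p = (dd v h p).2 := by
  simp only [dd]
  rw [(hh.differentiableAt.hasFDerivAt.snd).fderiv]; rfl

/-- The chain rule through the plane. -/
theorem dd_comp_at {f : ℝ × ℝ → F} {h : E → ℝ × ℝ} {p : E} (hf : SmoothNear f (h p))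
    (hh : SmoothNear h p) (v : E) :
    dd v (fun q => f (h q)) p = dd v (fun q => (h q).1) p • dd eu f (h p) +
      dd v (fun q => (h q).2) p • dd ev f (h p) := by
  rw [dd_fst hh, dd_snd hh]
  have := (hf.differentiableAt.hasFDerivAt.comp p hh.differentiableAt.hasFDerivAt).fderiv
  simp only [Function.comp_def] at this
  simp only [dd, this, ContinuousLinearMap.comp_apply]
  rw [fderiv_plane]; rfl

theorem dd_comp {f : ℝ × ℝ → F} {h : E → ℝ × ℝ} {p : E} (hf : SmoothNear f (h p))
    (hh : SmoothNear h p) (v : E) :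
    dd v (fun q => f (h q)) =ᶠ[𝓝 p] fun q => dd v (fun q => (h q).1) q • dd eu f (h q) +
      dd v (fun q => (h q).2) q • dd ev f (h q) := by
  filter_upwards [hh.continuousAt.eventually hf.eventually_smoothNear,
    hh.eventually_smoothNear] with q h1 h2
  exact dd_comp_at h1 h2 v

/-- The Jacobian determinant of a map of the plane. -/
noncomputable def jac (h : ℝ × ℝ → ℝ × ℝ) (p : ℝ × ℝ) : ℝ :=
  dd eu (fun q => (h q).1) p * dd ev (fun q => (h q).2) p -
    dd eu (fun q => (h q).2) p * dd ev (fun q => (h q).1) p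

theorem SmoothNear.jacobian {h : ℝ × ℝ → ℝ × ℝ} {p : ℝ × ℝ} (hh : SmoothNear h p) :
    SmoothNear (jac h) p :=
  ((hh.fst.along _).mul (hh.snd.along _)).sub ((hh.snd.along _).mul (hh.fst.along _))

theorem dd_eu_fst (p : ℝ × ℝ) : dd eu (fun q : ℝ × ℝ => q.1) p = 1 := by simp [dd, eu, fderiv_fst]
theorem dd_ev_fst (p : ℝ × ℝ) : dd ev (fun q : ℝ × ℝ => q.1) p = 0 := by simp [dd, ev, fderiv_fst]
theorem dd_ev_snd (p : ℝ × ℝ) : dd ev (fun q : ℝ × ℝ => q.2) p = 1 := by simp [dd, ev, fderiv_snd]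

theorem IsDiffeoGerm.jac_ne_zero {h : ℝ × ℝ → ℝ × ℝ} (hh : IsDiffeoGerm h) : jac h 0 ≠ 0 := by
  obtain ⟨h0, hs, k, k0, ks, hkh, -⟩ := hh
  have ks' : SmoothNear k (h 0) := by rwa [h0]
  have h1 : ∀ v, dd v (fun q => (k (h q)).1) 0 = dd v (fun q : ℝ × ℝ => q.1) 0 := fun v =>
    dd_congr_at (hkh.mono fun y hy => by simp [hy]) v
  have h2 : ∀ v, dd v (fun q => (k (h q)).2) 0 = dd v (fun q : ℝ × ℝ => q.2) 0 := fun v =>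
    dd_congr_at (hkh.mono fun y hy => by simp [hy]) v
  have a1 := h1 eu
  have a2 := h1 ev
  have b2 := h2 ev
  rw [dd_comp_at (f := fun q => (k q).1) ks'.fst hs] at a1 a2
  rw [dd_comp_at (f := fun q => (k q).2) ks'.snd hs] at b2
  rw [dd_eu_fst] at a1
  rw [dd_ev_fst] at a2
  rw [dd_ev_snd] at b2
  simp only [smul_eq_mul] at a1 a2 b2
  intro hj
  have : jac h 0 * (dd eu (fun q => (k q).1) (h 0) * dd ev (fun q => (k q).2) (h 0) -
      dd eu (fun q => (k q).2) (h 0) * dd ev (fun q => (k q).1) (h 0)) = 1 := by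
    rw [jac]
    linear_combination (dd ev (fun q ↦ (h q).1) 0 • dd eu (fun q ↦ (k q).2) (h 0) +
      dd ev (fun q ↦ (h q).2) 0 • dd ev (fun q ↦ (k q).2) (h 0)) * a1 + b2 -
      (dd eu (fun q ↦ (h q).1) 0 • dd eu (fun q ↦ (k q).2) (h 0) +
      dd eu (fun q ↦ (h q).2) 0 • dd ev (fun q ↦ (k q).2) (h 0)) * a2
  rw [hj] at this
  simp at this

theorem dd_comp_eq_zero {f : ℝ × ℝ → ℝ} {h : ℝ × ℝ → ℝ × ℝ} (hf : SmoothNear f 0)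
    (hh : SmoothNear h 0) (h0 : h 0 = 0) (h1 : dd eu f 0 = 0) (h2 : dd ev f 0 = 0) (v : ℝ × ℝ) :
    dd v (fun q => f (h q)) 0 = 0 := by
  rw [dd_comp_at (by rwa [h0]) hh, h0, h1, h2]; simp

/-- The Hessian determinant at a critical point is multiplied by the square of the Jacobian
determinant under a change of parameters. -/
theorem hessDet_comp {f : ℝ × ℝ → ℝ} {h : ℝ × ℝ → ℝ × ℝ} (hf : SmoothNear f 0)
    (hh : SmoothNear h 0) (h0 : h 0 = 0) (h1 : dd eu f 0 = 0) (h2 : dd ev f 0 = 0) :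
    hessDet eu ev (fun q => f (h q)) = jac h 0 ^ 2 * hessDet eu ev f := by
  have hf' : SmoothNear f (h 0) := by rwa [h0]
  have key : ∀ v w, dd v (dd w fun q => f (h q)) 0 =
      dd w (fun q => (h q).1) 0 * (dd v (fun q => (h q).1) 0 * dd eu (dd eu f) 0 +
        dd v (fun q => (h q).2) 0 * dd ev (dd eu f) 0) +
      dd w (fun q => (h q).2) 0 * (dd v (fun q => (h q).1) 0 * dd eu (dd ev f) 0 +
        dd v (fun q => (h q).2) 0 * dd ev (dd ev f) 0) := by
    intro v w
    rw [dd_congr_at (dd_comp hf' hh w)]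
    simp only [smul_eq_mul]
    have s1 := (hf'.along eu).comp hh
    have s2 := (hf'.along ev).comp hh
    rw [dd_add_at ((hh.fst.along w).mul s1) ((hh.snd.along w).mul s2), dd_mul_at (hh.fst.along w) s1,
      dd_mul_at (hh.snd.along w) s2, dd_comp_at (hf'.along eu) hh, dd_comp_at (hf'.along ev) hh, h0, h1, h2]
    simp only [smul_eq_mul]
    ring
  simp only [hessDet, key, jac, dd_comm hf ev eu]
  ring

end Plane

end Minkowski

namespace Minkowski

section Morse

/-- The quadratic form with coefficients `(a, b, c)`. -/
def quad (a : ℝ × ℝ × ℝ) (p : ℝ × ℝ) : ℝ :=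
  a.1 * p.1 ^ 2 + 2 * a.2.1 * (p.1 * p.2) + a.2.2 * p.2 ^ 2

/-- The determinant of a quadratic form. -/
def quadDet (a : ℝ × ℝ × ℝ) : ℝ := a.1 * a.2.2 - a.2.1 ^ 2

/-- The matrix `1 + adj(a) s` of entries `m₁₁, m₂₁, m₁₂, m₂₂`, for symmetric matrices `a`, `s`. -/
def slice (a s : ℝ × ℝ × ℝ) : (ℝ × ℝ) × (ℝ × ℝ) :=
  ((1 + a.2.2 * s.1 - a.2.1 * s.2.1, -a.2.1 * s.1 + a.1 * s.2.1),
   (a.2.2 * s.2.1 - a.2.1 * s.2.2, 1 - a.2.1 * s.2.1 + a.1 * s.2.2))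

/-- The product of a matrix, given by its columns, and a vector. -/
def colMul (m : (ℝ × ℝ) × (ℝ × ℝ)) (p : ℝ × ℝ) : ℝ × ℝ :=
  (m.1.1 * p.1 + m.2.1 * p.2, m.1.2 * p.1 + m.2.2 * p.2)

/-- The coefficients of the quadratic form `quad a` composed with a matrix. -/
def pull (a : ℝ × ℝ × ℝ) (m : (ℝ × ℝ) × (ℝ × ℝ)) : ℝ × ℝ × ℝ :=
  (a.1 * m.1.1 ^ 2 + 2 * a.2.1 * (m.1.1 * m.1.2) + a.2.2 * m.1.2 ^ 2,
   a.1 * (m.1.1 * m.2.1) + a.2.1 * (m.1.1 * m.2.2 + m.1.2 * m.2.1) + a.2.2 * (m.1.2 * m.2.2),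
   a.1 * m.2.1 ^ 2 + 2 * a.2.1 * (m.2.1 * m.2.2) + a.2.2 * m.2.2 ^ 2)

theorem quad_colMul (a : ℝ × ℝ × ℝ) (m : (ℝ × ℝ) × (ℝ × ℝ)) (p : ℝ × ℝ) :
    quad a (colMul m p) = quad (pull a m) p := by
  simp only [quad, colMul, pull]; ring

theorem slice_zero (a : ℝ × ℝ × ℝ) : slice a 0 = ((1, 0), (0, 1)) := by simp [slice]

theorem contDiff_slice (a : ℝ × ℝ × ℝ) : ContDiff ℝ ∞ (slice a) := by
  unfold slice; fun_prop

theorem contDiff_colMul : ContDiff ℝ ∞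
    (fun q : ((ℝ × ℝ) × (ℝ × ℝ)) × (ℝ × ℝ) => colMul q.1 q.2) := by
  unfold colMul; fun_prop

theorem contDiff_pull : ContDiff ℝ ∞
    (fun q : (ℝ × ℝ × ℝ) × ((ℝ × ℝ) × (ℝ × ℝ)) => pull q.1 q.2) := by
  unfold pull; fun_prop

theorem pull_slice (a s : ℝ × ℝ × ℝ) : ∃ r : ℝ × ℝ × ℝ, ∀ t : ℝ,
    pull a (slice a (t • s)) = a + t • ((2 * quadDet a) • s) + t ^ 2 • r := by
  refine ⟨pull a ((a.2.2 * s.1 - a.2.1 * s.2.1, -a.2.1 * s.1 + a.1 * s.2.1),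
   (a.2.2 * s.2.1 - a.2.1 * s.2.2, - a.2.1 * s.2.1 + a.1 * s.2.2)), fun t => ?_⟩
  ext <;> simp [pull, slice, quadDet] <;> ring

variable {Z : Type} [NormedAddCommGroup Z] [NormedSpace ℝ Z] [FiniteDimensional ℝ Z]

/-- Two families of nondegenerate quadratic forms, depending on the point and on parameters, which
agree at the origin, define equivalent families of functions. -/
theorem exists_quad_eq {α β : (ℝ × ℝ) × Z → ℝ × ℝ × ℝ} (hα : SmoothNear α 0)
    (hβ : SmoothNear β 0) (h0 : α 0 = β 0) (hdet : quadDet (α 0) ≠ 0) :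
    ∃ m : (ℝ × ℝ) × Z → (ℝ × ℝ) × (ℝ × ℝ), SmoothNear m 0 ∧ m 0 = ((1, 0), (0, 1)) ∧
      (∀ᶠ q in 𝓝 0, quad (α (colMul (m q) q.1, q.2)) (colMul (m q) q.1) = quad (β q) q.1) ∧
      ∀ᶠ q in 𝓝 0, α q = β q → m q = ((1, 0), (0, 1)) := by
  set a := α 0 with ha
  let y : (ℝ × ℝ × ℝ) × ((ℝ × ℝ) × Z) → (ℝ × ℝ) × Z := fun r =>
    (colMul (slice a r.1) r.2.1, r.2.2)
  let H : (ℝ × ℝ × ℝ) × ((ℝ × ℝ) × Z) → ℝ × ℝ × ℝ := fun r =>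
    pull (α (y r)) (slice a r.1) - β r.2
  have hid : SmoothNear (fun r : (ℝ × ℝ × ℝ) × ((ℝ × ℝ) × Z) => r) 0 := smoothNear_id _
  have hsl : SmoothNear (fun r : (ℝ × ℝ × ℝ) × ((ℝ × ℝ) × Z) => slice a r.1) 0 :=
    (ContDiff.smoothNear (contDiff_slice a) _).comp hid.fst
  have hy : SmoothNear y 0 :=
    ((ContDiff.smoothNear contDiff_colMul _).comp (hsl.prodMk hid.snd.fst)).prodMk hid.snd.snd
  have hy0 : ∀ s, y (s, 0) = 0 := by intro s; simp [y, colMul]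
  have hH : SmoothNear H 0 :=
    ((ContDiff.smoothNear contDiff_pull _).comp ((hα.comp_of_eq hy (hy0 0)).prodMk hsl)).sub
      (hβ.comp_of_eq hid.snd rfl)
  have hHs : ∀ s, H (s, 0) = pull a (slice a s) - a := by
    intro s
    simp only [H, hy0, ← h0, ← ha]
  have hH0 : H 0 = 0 := by
    have := hHs 0
    rw [slice_zero] at this
    change H 0 = _ at this
    rw [this]; ext <;> simp [pull]
  have hinj : ∀ s, fderiv ℝ H 0 (s, 0) = 0 → s = 0 := by
    intro s hs
    have e1 : HasDerivAt (fun t : ℝ => H (t • (s, (0 : (ℝ × ℝ) × Z)))) 0 0 := by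
      have h1 : HasDerivAt (fun t : ℝ => t • (s, (0 : (ℝ × ℝ) × Z))) (s, 0) 0 := by
        simpa using (hasDerivAt_id (0 : ℝ)).smul_const (s, (0 : (ℝ × ℝ) × Z))
      have h2 : HasFDerivAt H (fderiv ℝ H 0) ((0 : ℝ) • (s, (0 : (ℝ × ℝ) × Z))) := by
        rw [zero_smul]; exact hH.differentiableAt.hasFDerivAt
      have := h2.comp_hasDerivAt 0 h1
      rwa [hs] at this
    obtain ⟨r, hr⟩ := pull_slice a s
    have e2 : HasDerivAt (fun t : ℝ => H (t • (s, (0 : (ℝ × ℝ) × Z))))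
        ((2 * quadDet a) • s) 0 := by
      have : (fun t : ℝ => H (t • (s, (0 : (ℝ × ℝ) × Z)))) =
          fun t => t • ((2 * quadDet a) • s) + t ^ 2 • r := by
        funext t
        rw [Prod.smul_mk, smul_zero, hHs, hr]; abel
      rw [this]
      simpa using ((hasDerivAt_id (0 : ℝ)).smul_const ((2 * quadDet a) • s)).fun_add
        (((hasDerivAt_id (0 : ℝ)).fun_pow 2).smul_const r)
    have := e2.unique e1
    exact (smul_eq_zero.1 this).resolve_left (mul_ne_zero two_ne_zero hdet)
  obtain ⟨φ, hφ, hφ0, hsol, huniq⟩ := hH.exists_implicit hH0 hinj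
  refine ⟨fun q => slice a (φ q), (ContDiff.smoothNear (contDiff_slice a) _).comp hφ, ?_, ?_, ?_⟩
  · simp only [hφ0, slice_zero]
  · filter_upwards [hsol] with q hq
    rw [quad_colMul]
    have : pull (α (y (φ q, q))) (slice a (φ q)) = β q := sub_eq_zero.1 hq
    rw [← this]
  · have ht : Tendsto (fun q : (ℝ × ℝ) × Z => ((0 : ℝ × ℝ × ℝ), q)) (𝓝 0) (𝓝 0) := by
      have : Continuous (fun q : (ℝ × ℝ) × Z => ((0 : ℝ × ℝ × ℝ), q)) := by fun_prop
      exact this.continuousAt (x := 0)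
    filter_upwards [ht.eventually huniq] with q hq hab
    have : φ q = 0 := by
      refine (hq ?_).symm
      have : pull (β q) ((1, 0), (0, 1)) = β q := by ext <;> simp [pull]
      simp [H, y, slice_zero, colMul, hab, this]
    simp only [this, slice_zero]

/-- Two derivatives of a product with a function vanishing to second order. -/
theorem dd_dd_mul_mul {E : Type*} [NormedAddCommGroup E] [NormedSpace ℝ E] {x y g : E → ℝ} {a : E}
    (hx : SmoothNear x a) (hy : SmoothNear y a) (hg : SmoothNear g a) (hx0 : x a = 0)
    (hy0 : y a = 0) (v w : E) :
    dd v (dd w fun p => x p * (y p * g p)) a =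
      (dd v x a * dd w y a + dd w x a * dd v y a) * g a := by
  rw [dd_mul_at₂ hx (hy.mul hg), dd_mul_at hy hg, dd_mul_at hy hg, hx0, hy0]
  ring

/-- A family of functions with a critical point of value zero at the origin is a family of quadratic
forms with smooth coefficients. -/
theorem SmoothNear.exists_quad {f : (ℝ × ℝ) × Z → ℝ} (hf : SmoothNear f 0)
    (h0 : ∀ᶠ z in 𝓝 (0 : Z), f (0, z) = 0)
    (h1 : ∀ᶠ z in 𝓝 (0 : Z), dd (eu, 0) f (0, z) = 0)
    (h2 : ∀ᶠ z in 𝓝 (0 : Z), dd (ev, 0) f (0, z) = 0) :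
    ∃ α : (ℝ × ℝ) × Z → ℝ × ℝ × ℝ, SmoothNear α 0 ∧ (∀ᶠ q in 𝓝 0, f q = quad (α q) q.1) ∧
      hessDet (eu, 0) (ev, 0) f = 4 * quadDet (α 0) := by
  have ht : Tendsto (fun z : Z => ((0 : ℝ × ℝ), z)) (𝓝 0) (𝓝 0) := by
    have : Continuous (fun z : Z => ((0 : ℝ × ℝ), z)) := by fun_prop
    exact this.continuousAt (x := 0)
  have hid : ∀ q, SmoothNear (fun r : (ℝ × ℝ) × Z => r) q := fun q => smoothNear_id _
  have hu : ∀ q, SmoothNear (fun r : (ℝ × ℝ) × Z => r.1.1) q := fun q => (hid q).fst.fst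
  have hv : ∀ q, SmoothNear (fun r : (ℝ × ℝ) × Z => r.1.2) q := fun q => (hid q).fst.snd
  have du : ∀ (w : ℝ × ℝ) (q : (ℝ × ℝ) × Z), dd (w, 0) (fun r : (ℝ × ℝ) × Z => r.1.1) q = w.1 := by
    intro w q
    simp only [dd]
    rw [((hasFDerivAt_id q).fst.fst).fderiv]; rfl
  have dv : ∀ (w : ℝ × ℝ) (q : (ℝ × ℝ) × Z), dd (w, 0) (fun r : (ℝ × ℝ) × Z => r.1.2) q = w.2 := by
    intro w q
    simp only [dd]
    rw [((hasFDerivAt_id q).fst.snd).fderiv]; rfl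
  obtain ⟨a, b, ha, hb, hab⟩ := hf.hadamard h0
  have hab' : f =ᶠ[𝓝 0] fun q => q.1.1 * a q + q.1.2 * b q := hab
  have hd : ∀ w : ℝ × ℝ, ∀ᶠ z in 𝓝 (0 : Z),
      dd (w, 0) f (0, z) = w.1 * a (0, z) + w.2 * b (0, z) := by
    intro w
    filter_upwards [ht.eventually hab'.eventuallyEq_nhds, ht.eventually ha.eventually_smoothNear,
      ht.eventually hb.eventually_smoothNear] with z h1 h2 h3
    rw [dd_congr_at h1, dd_add_at ((hu _).mul h2) ((hv _).mul h3), dd_mul_at (hu _) h2,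
      dd_mul_at (hv _) h3, du, dv]
    simp
  obtain ⟨a1, a2, ha1, ha2, ha12⟩ := ha.hadamard (by
    filter_upwards [h1, hd eu] with z e1 e2
    rw [e1] at e2; simpa [eu] using e2.symm)
  obtain ⟨b1, b2, hb1, hb2, hb12⟩ := hb.hadamard (by
    filter_upwards [h2, hd ev] with z e1 e2
    rw [e1] at e2; simpa [ev] using e2.symm)
  refine ⟨fun q => (a1 q, (1 / 2) * (a2 q + b1 q), b2 q),
    ha1.prodMk (((smoothNear_const _ _).mul (ha2.add hb1)).prodMk hb2), ?_, ?_⟩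
  · filter_upwards [hab, ha12, hb12] with q e1 e2 e3
    rw [e1, e2, e3]; simp only [quad]; ring
  · have hf2 : f =ᶠ[𝓝 0] fun q => (q.1.1 * (q.1.1 * a1 q) + q.1.1 * (q.1.2 * a2 q)) +
        (q.1.1 * (q.1.2 * b1 q) + q.1.2 * (q.1.2 * b2 q)) := by
      filter_upwards [hab, ha12, hb12] with q e1 e2 e3
      rw [e1, e2, e3]; ring
    have key : ∀ v w : ℝ × ℝ, dd (v, 0) (dd (w, 0) f) 0 =
        2 * v.1 * w.1 * a1 0 + (v.1 * w.2 + w.1 * v.2) * (a2 0 + b1 0) +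
        2 * v.2 * w.2 * b2 0 := by
      intro v w
      have s1 := (hu 0).mul ((hu 0).mul ha1)
      have s2 := (hu 0).mul ((hv 0).mul ha2)
      have s3 := (hu 0).mul ((hv 0).mul hb1)
      have s4 := (hv 0).mul ((hv 0).mul hb2)
      rw [dd_congr_at₂ hf2, dd_add_at₂ (s1.add s2) (s3.add s4), dd_add_at₂ s1 s2, dd_add_at₂ s3 s4,
        dd_dd_mul_mul (hu 0) (hu 0) ha1 rfl rfl, dd_dd_mul_mul (hu 0) (hv 0) ha2 rfl rfl,
        dd_dd_mul_mul (hu 0) (hv 0) hb1 rfl rfl, dd_dd_mul_mul (hv 0) (hv 0) hb2 rfl rfl]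
      simp only [du, dv]
      ring
    simp only [hessDet, key, quadDet, eu, ev]
    ring

end Morse

end Minkowski

namespace Minkowski

section Slices

theorem tendsto_prodMk_right {E Y : Type*} [TopologicalSpace E] [TopologicalSpace Y]
    (p : E) (t : Y) :
    Tendsto (fun p : E => (p, t)) (𝓝 p) (𝓝 (p, t)) :=
  (continuous_id.prodMk continuous_const).continuousAt (x := p)

theorem tendsto_prodMk_left {E Y : Type*} [TopologicalSpace E] [TopologicalSpace Y]
    (p : E) (t : Y) :
    Tendsto (fun t : Y => (p, t)) (𝓝 t) (𝓝 (p, t)) :=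
  (continuous_const.prodMk continuous_id).continuousAt (x := t)

variable {E Y F : Type*} [NormedAddCommGroup E] [NormedSpace ℝ E]
  [NormedAddCommGroup F] [NormedSpace ℝ F] [NormedAddCommGroup Y] [NormedSpace ℝ Y]

theorem dd_translate {K : E × Y → F} {c p : E} {t : Y} (hK : DifferentiableAt ℝ K (c + p, t))
    (v : E) : dd v (fun p => K (c + p, t)) p = dd (v, 0) K (c + p, t) := by
  have h1 : HasFDerivAt (fun p : E => (c + p, t))
      ((ContinuousLinearMap.id ℝ E).prod (0 : E →L[ℝ] Y)) p :=
    ((hasFDerivAt_id p).const_add c).prodMk (hasFDerivAt_const t p)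
  have := (hK.hasFDerivAt.comp p h1).fderiv
  simp only [Function.comp_def] at this
  simp [dd, this]

theorem dd_slice {K : E × Y → F} {p : E} {t : Y} (hK : DifferentiableAt ℝ K (p, t))
    (v : E) : dd v (fun p => K (p, t)) p = dd (v, 0) K (p, t) := by
  have := dd_translate (c := 0) (p := p) (t := t) (by simpa using hK) v
  simpa using this

theorem SmoothNear.slice {K : E × Y → F} {p : E} {t : Y} (hK : SmoothNear K (p, t)) :
    SmoothNear (fun p => K (p, t)) p :=
  hK.comp_of_eq (f := fun p => (p, t)) ((smoothNear_id p).prodMk (smoothNear_const t p)) rfl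

theorem dd_slice_eventually {K : E × Y → F} {p : E} {t : Y} (hK : SmoothNear K (p, t)) (v : E) :
    dd v (fun p => K (p, t)) =ᶠ[𝓝 p] fun p => dd (v, 0) K (p, t) := by
  filter_upwards [(tendsto_prodMk_right p t).eventually hK] with y hy
  exact dd_slice (hy.differentiableAt (by simp)) v

theorem dd_dd_slice {K : E × Y → F} {p : E} {t : Y} (hK : SmoothNear K (p, t)) (v w : E) :
    dd v (dd w (fun p => K (p, t))) p = dd (v, 0) (dd (w, 0) K) (p, t) := by
  rw [dd_congr_at (dd_slice_eventually hK w), dd_slice (hK.along _).differentiableAt]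

theorem hessDet_slice {K : E × Y → ℝ} (hK : SmoothNear K 0) (v w : E) :
    hessDet v w (fun p => K (p, 0)) = hessDet (v, 0) (w, 0) K := by
  have hK' : SmoothNear K ((0 : E), (0 : Y)) := hK
  simp only [hessDet, dd_dd_slice hK']; rfl

theorem dd_add_smul (f : (ℝ × ℝ) × Y → F) (p : (ℝ × ℝ) × Y) (v : ℝ × ℝ) (τ : Y) :
    dd (v, τ) f p = v.1 • dd (eu, 0) f p + v.2 • dd (ev, 0) f p + dd (0, τ) f p := by
  have : (v, τ) = v.1 • (eu, (0 : Y)) + v.2 • (ev, (0 : Y)) + (0, τ) := by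
    ext <;> simp [eu, ev]
  simp only [dd]
  rw [this, map_add, map_add, map_smul, map_smul]

end Slices

section MorseLemma

theorem dd_dd_quad (a : ℝ × ℝ × ℝ) (v w p : ℝ × ℝ) (hp : p = 0) : dd v (dd w (quad a)) p =
    2 * (a.1 * v.1 * w.1 + a.2.1 * (v.1 * w.2 + v.2 * w.1) + a.2.2 * v.2 * w.2) := by
  subst hp
  have hid : SmoothNear (fun r : ℝ × ℝ => r) 0 := smoothNear_id _
  have hc : ∀ c : ℝ, SmoothNear (fun _ : ℝ × ℝ => c) 0 := fun c => smoothNear_const _ _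
  have e : quad a = fun p => p.1 * (p.1 * a.1) + p.1 * (p.2 * (2 * a.2.1)) +
      p.2 * (p.2 * a.2.2) := by
    funext p; simp only [quad]; ring
  have s1 := hid.fst.mul (hid.fst.mul (hc a.1))
  have s2 := hid.fst.mul (hid.snd.mul (hc (2 * a.2.1)))
  have s3 := hid.snd.mul (hid.snd.mul (hc a.2.2))
  have d1 : ∀ v : ℝ × ℝ, dd v (fun r : ℝ × ℝ => r.1) 0 = v.1 := fun v => by
    rw [dd_fst hid]; simp [dd]
  have d2 : ∀ v : ℝ × ℝ, dd v (fun r : ℝ × ℝ => r.2) 0 = v.2 := fun v => by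
    rw [dd_snd hid]; simp [dd]
  rw [e, dd_add_at₂ (s1.add s2) s3, dd_add_at₂ s1 s2,
    dd_dd_mul_mul hid.fst hid.fst (hc _) rfl rfl, dd_dd_mul_mul hid.fst hid.snd (hc _) rfl rfl,
    dd_dd_mul_mul hid.snd hid.snd (hc _) rfl rfl]
  simp only [d1, d2]; ring

theorem hessDet_quad (a : ℝ × ℝ × ℝ) : hessDet eu ev (quad a) = 4 * quadDet a := by
  simp only [hessDet, dd_dd_quad a _ _ 0 rfl, quadDet, eu, ev]; ring

theorem contDiff_quad (a : ℝ × ℝ × ℝ) : ContDiff ℝ ∞ (quad a) := by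
  unfold quad; fun_prop

theorem dd_quad_zero (a : ℝ × ℝ × ℝ) (v : ℝ × ℝ) : dd v (quad a) 0 = 0 := by
  have hid : SmoothNear (fun r : ℝ × ℝ => r) 0 := smoothNear_id _
  have hc : ∀ c : ℝ, SmoothNear (fun _ : ℝ × ℝ => c) 0 := fun c => smoothNear_const _ _
  have e : quad a = fun p => p.1 * (p.1 * a.1 + p.2 * (2 * a.2.1)) + p.2 * (p.2 * a.2.2) := by
    funext p; simp only [quad]; ring
  have s1 := (hid.fst.mul (hc a.1)).add (hid.snd.mul (hc (2 * a.2.1)))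
  have s2 := hid.snd.mul (hc a.2.2)
  rw [e, dd_add_at (hid.fst.mul s1) (hid.snd.mul s2), dd_mul_at hid.fst s1, dd_mul_at hid.snd s2]
  simp

theorem HasA1.hessDet_ne_zero {f : ℝ × ℝ → ℝ} (h : HasA1 f) : hessDet eu ev f ≠ 0 := by
  obtain ⟨a, b, ha, hb, g, hg, he⟩ := h
  have hq : (fun p : ℝ × ℝ => a * (p.1 ^ 2 + b * p.2 ^ 2)) = quad (a, 0, a * b) := by
    funext p; simp only [quad]; ring
  have he' : f =ᶠ[𝓝 0] fun y => quad (a, 0, a * b) (g y) := by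
    filter_upwards [he] with y hy
    rw [← hy, ← hq]
  rw [hessDet_congr he', hessDet_comp (ContDiff.smoothNear (contDiff_quad _) _) hg.2.1 hg.1
    (dd_quad_zero _ _) (dd_quad_zero _ _), hessDet_quad]
  have hJ := hg.jac_ne_zero
  have : quadDet (a, 0, a * b) ≠ 0 := by
    simp only [quadDet]
    rcases ha with rfl | rfl <;> rcases hb with rfl | rfl <;> norm_num
  positivity

theorem isDiffeoGerm_of_inverse {h k : ℝ × ℝ → ℝ × ℝ} (hh : ContDiff ℝ ∞ h) (hk : ContDiff ℝ ∞ k)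
    (h0 : h 0 = 0) (hkh : ∀ p, k (h p) = p) (hhk : ∀ p, h (k p) = p) : IsDiffeoGerm h :=
  ⟨h0, ContDiff.smoothNear hh _, k, by simpa [h0] using hkh 0, ContDiff.smoothNear hk _,
    Eventually.of_forall hkh, Eventually.of_forall hhk⟩

theorem HasA1.of_rEquiv {f g : ℝ × ℝ → ℝ} (hg : HasA1 g) (h : REquiv f g) : HasA1 f := by
  obtain ⟨a, b, ha, hb, hab⟩ := hg
  exact ⟨a, b, ha, hb, h.trans hab⟩

theorem hasA1_quad_of_fst_ne_zero {a : ℝ × ℝ × ℝ} (ha : quadDet a ≠ 0) (h1 : a.1 ≠ 0) :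
    HasA1 (quad a) := by
  obtain ⟨a, b, c⟩ := a
  simp only [quadDet] at ha h1
  obtain ⟨ε, hε, hεa⟩ : ∃ ε : ℝ, (ε = 1 ∨ ε = -1) ∧ 0 < ε * a := by
    rcases lt_or_gt_of_ne h1 with h | h
    · exact ⟨-1, Or.inr rfl, by linarith⟩
    · exact ⟨1, Or.inl rfl, by linarith⟩
  have hε2 : ε * ε = 1 := by rcases hε with rfl | rfl <;> norm_num
  obtain ⟨δ, hδ, hδa⟩ : ∃ δ : ℝ, (δ = 1 ∨ δ = -1) ∧ 0 < δ * (a * c - b ^ 2) := by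
    rcases lt_or_gt_of_ne ha with h | h
    · exact ⟨-1, Or.inr rfl, by linarith⟩
    · exact ⟨1, Or.inl rfl, by linarith⟩
  have hδ2 : δ * δ = 1 := by rcases hδ with rfl | rfl <;> norm_num
  obtain ⟨r, hr, hr2⟩ : ∃ r : ℝ, 0 < r ∧ r ^ 2 = ε * a :=
    ⟨√(ε * a), Real.sqrt_pos.2 hεa, Real.sq_sqrt hεa.le⟩
  obtain ⟨s, hs, hs2⟩ : ∃ s : ℝ, 0 < s ∧ s ^ 2 = δ * (a * c - b ^ 2) / (ε * a) :=
    ⟨√(δ * (a * c - b ^ 2) / (ε * a)), Real.sqrt_pos.2 (by positivity),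
      Real.sq_sqrt (by positivity)⟩
  have hε0 : ε ≠ 0 := by rintro rfl; simp at hε2
  refine ⟨ε, δ, hε, hδ, fun p => (r * (p.1 + b / a * p.2), s * p.2),
    isDiffeoGerm_of_inverse (k := fun p => (p.1 / r - b / a * (p.2 / s), p.2 / s))
      (by fun_prop) (by fun_prop) (by simp) (fun p => ?_) (fun p => ?_),
      Eventually.of_forall fun p => ?_⟩
  · ext <;> simp <;> field_simp; ring
  · ext <;> simp <;> field_simp
  · simp only [quad, mul_pow, hr2]
    have hca : s ^ 2 = ε * δ * (c - b ^ 2 / a) := by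
      have : ε * δ * (c - b ^ 2 / a) * (ε * a) = (ε * ε) * (δ * (a * c - b ^ 2)) := by
        field_simp
      rw [hs2, div_eq_iff hεa.ne', this, hε2, one_mul]
    rw [hca]
    have e1 : ε * (ε * a * (p.1 + b / a * p.2) ^ 2 + δ * (ε * δ * (c - b ^ 2 / a) * p.2 ^ 2)) =
      (ε * ε) * (a * (p.1 + b / a * p.2) ^ 2) + (ε * ε) * (δ * δ) * (c - b ^ 2 / a) * p.2 ^ 2 := by
      ring
    rw [e1, hε2, hδ2]
    field_simp
    ring

theorem hasA1_quad {a : ℝ × ℝ × ℝ} (ha : quadDet a ≠ 0) : HasA1 (quad a) := by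
  obtain ⟨k, hk⟩ : ∃ k : ℝ, a.1 + 2 * a.2.1 * k + a.2.2 * k ^ 2 ≠ 0 := by
    by_contra! h
    have h0 := h 0
    have h1 := h 1
    have h2 := h (-1)
    apply ha
    have e1 : a.1 = 0 := by linarith
    have e2 : a.2.1 = 0 := by linarith
    simp [quadDet, e1, e2]
  refine HasA1.of_rEquiv (hasA1_quad_of_fst_ne_zero
    (a := (a.1 + 2 * a.2.1 * k + a.2.2 * k ^ 2, a.2.1 + a.2.2 * k, a.2.2)) ?_ hk)
    ⟨fun p => (p.1, p.2 - k * p.1), isDiffeoGerm_of_inverse (k := fun p => (p.1, p.2 + k * p.1))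
      (by fun_prop) (by fun_prop) (by simp) (fun p => ?_) (fun p => ?_),
      Eventually.of_forall fun p => ?_⟩
  · convert ha using 1
    simp only [quadDet]; ring
  · simp
  · simp
  · simp only [quad]; ring

/-- The Morse lemma in the plane. -/
theorem hasA1_of_hessDet_ne_zero {f : ℝ × ℝ → ℝ} (hf : SmoothNear f 0) (h0 : f 0 = 0)
    (h1 : dd eu f 0 = 0) (h2 : dd ev f 0 = 0) (hdet : hessDet eu ev f ≠ 0) : HasA1 f := by
  let F : (ℝ × ℝ) × ℝ → ℝ := fun q => f q.1
  have hF : ∀ z : ℝ, SmoothNear F (0, z) := fun z =>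
    hf.comp_of_eq (f := fun q : (ℝ × ℝ) × ℝ => q.1) (smoothNear_id _).fst rfl
  obtain ⟨α, hα, hαF, hαdet⟩ := (hF 0).exists_quad (Eventually.of_forall fun z => h0)
    (Eventually.of_forall fun z => by rw [← dd_slice (hF z).differentiableAt]; exact h1)
    (Eventually.of_forall fun z => by rw [← dd_slice (hF z).differentiableAt]; exact h2)
  rw [← hessDet_slice (hF 0)] at hαdet
  have hd0 : quadDet (α 0) ≠ 0 := by
    intro h
    rw [h, mul_zero] at hαdet
    exact hdet hαdet
  obtain ⟨m, hm, hm0, hmq, -⟩ := exists_quad_eq (smoothNear_const (α 0) 0) hα rfl hd0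
  refine HasA1.of_rEquiv (hasA1_quad hd0) ?_
  have ht : Tendsto (fun p : ℝ × ℝ => (p, (0 : ℝ))) (𝓝 0) (𝓝 0) := tendsto_prodMk_right 0 0
  let h : ℝ × ℝ → ℝ × ℝ := fun p => colMul (m (p, 0)) p
  have hms : SmoothNear (fun p : ℝ × ℝ => m (p, 0)) 0 := SmoothNear.slice hm
  have hh : SmoothNear h 0 :=
    (ContDiff.smoothNear contDiff_colMul _).comp (hms.prodMk (smoothNear_id _))
  have hh0 : h 0 = 0 := by simp [h, colMul]
  have hder : fderiv ℝ h 0 = (ContinuousLinearEquiv.refl ℝ (ℝ × ℝ) : ℝ × ℝ →L[ℝ] ℝ × ℝ) := by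
    have d1 := hms.fst.fst.differentiableAt.hasFDerivAt
    have d2 := hms.fst.snd.differentiableAt.hasFDerivAt
    have d3 := hms.snd.fst.differentiableAt.hasFDerivAt
    have d4 := hms.snd.snd.differentiableAt.hasFDerivAt
    have u : HasFDerivAt (fun p : ℝ × ℝ => p.1) (ContinuousLinearMap.fst ℝ ℝ ℝ) 0 := hasFDerivAt_fst
    have v : HasFDerivAt (fun p : ℝ × ℝ => p.2) (ContinuousLinearMap.snd ℝ ℝ ℝ) 0 := hasFDerivAt_snd
    have := (((d1.fun_mul u).fun_add (d3.fun_mul v)).prodMk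
      ((d2.fun_mul u).fun_add (d4.fun_mul v))).fderiv
    have hm0' : m ((0 : ℝ × ℝ), (0 : ℝ)) = ((1, 0), (0, 1)) := hm0
    change fderiv ℝ h 0 = _ at this
    rw [this]
    ext <;> simp [hm0']
  obtain ⟨k, hk, hk0, hkh, hhk⟩ := hh.exists_inverse hh0 _ hder
  refine ⟨h, ⟨hh0, hh, k, hk0, hk, hkh, hhk⟩, ?_⟩
  filter_upwards [ht.eventually hmq, ht.eventually hαF] with p h1 h2
  rw [h1, ← h2]

end MorseLemma

end Minkowski

namespace Minkowski

section Versality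

variable {Y Z : Type} [NormedAddCommGroup Y] [NormedSpace ℝ Y]
  [NormedAddCommGroup Z] [NormedSpace ℝ Z] [FiniteDimensional ℝ Z]

/-- A family of functions near a family of critical points is a family of quadratic forms. -/
theorem SmoothNear.exists_quad_of_critical {K : (ℝ × ℝ) × Y → ℝ} (hK : SmoothNear K 0)
    {c : Z → ℝ × ℝ} {θ : Z → Y} {γ : Z → ℝ} (hc : SmoothNear c 0) (hθ : SmoothNear θ 0)
    (hγ : SmoothNear γ 0) (hc0 : c 0 = 0) (hθ0 : θ 0 = 0)
    (hval : ∀ᶠ z in 𝓝 (0 : Z), K (c z, θ z) = γ z)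
    (h1 : ∀ᶠ z in 𝓝 (0 : Z), dd (eu, 0) K (c z, θ z) = 0)
    (h2 : ∀ᶠ z in 𝓝 (0 : Z), dd (ev, 0) K (c z, θ z) = 0) :
    ∃ α : (ℝ × ℝ) × Z → ℝ × ℝ × ℝ, SmoothNear α 0 ∧
      (∀ᶠ q in 𝓝 0, K (c q.2 + q.1, θ q.2) = γ q.2 + quad (α q) q.1) ∧
      hessDet (eu, 0) (ev, 0) K = 4 * quadDet (α 0) := by
  let A : (ℝ × ℝ) × Z → ℝ := fun q => K (c q.2 + q.1, θ q.2) - γ q.2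
  have hid : SmoothNear (fun r : (ℝ × ℝ) × Z => r) 0 := smoothNear_id _
  have hin : SmoothNear (fun q : (ℝ × ℝ) × Z => (c q.2 + q.1, θ q.2)) 0 :=
    ((hc.comp_of_eq hid.snd rfl).add hid.fst).prodMk (hθ.comp_of_eq hid.snd rfl)
  have hA : SmoothNear A 0 :=
    (hK.comp_of_eq hin (by simp [hc0, hθ0])).sub (hγ.comp_of_eq hid.snd rfl)
  have ht : Tendsto (fun z : Z => ((0 : ℝ × ℝ), z)) (𝓝 0) (𝓝 0) := tendsto_prodMk_left 0 0
  have hcθ : Tendsto (fun z : Z => (c z, θ z)) (𝓝 0) (𝓝 0) := by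
    have := (hc.prodMk hθ).continuousAt
    rw [ContinuousAt, hc0, hθ0] at this
    exact this
  have hd : ∀ w : ℝ × ℝ, ∀ᶠ z in 𝓝 (0 : Z), dd (w, 0) A (0, z) = dd (w, 0) K (c z, θ z) := by
    intro w
    filter_upwards [ht.eventually hA, hcθ.eventually hK.eventually_smoothNear] with z e1 e2
    have e3 : SmoothNear K (c z + 0, θ z) := by rwa [add_zero]
    rw [← dd_slice (e1.differentiableAt (by simp))]
    have hs : SmoothNear (fun p : ℝ × ℝ => K (c z + p, θ z)) 0 :=
      e3.comp (f := fun p : ℝ × ℝ => (c z + p, θ z))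
        (((smoothNear_const _ _).add (smoothNear_id _)).prodMk (smoothNear_const _ _))
    simp only [A]
    rw [dd_sub_at hs (smoothNear_const _ _), dd_const, dd_translate e3.differentiableAt, add_zero,
      sub_zero]
  obtain ⟨α, hα, hαA, hdet⟩ := hA.exists_quad
    (by filter_upwards [hval] with z hz; simp [A, hz])
    (by filter_upwards [h1, hd eu] with z e1 e2; rw [e2, e1])
    (by filter_upwards [h2, hd ev] with z e1 e2; rw [e2, e1])
  refine ⟨α, hα, ?_, ?_⟩
  · filter_upwards [hαA] with q hq
    rw [← hq]; simp [A]
  · rw [← hdet, ← hessDet_slice hA, ← hessDet_slice hK]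
    have hs : ∀ w, dd w (fun p : ℝ × ℝ => K (p, 0) - γ 0) = dd w fun p => K (p, 0) := by
      intro w; funext p; simp only [dd, fderiv_sub_const]
    simp only [hessDet, A, hc0, hθ0, zero_add, hs]

theorem eq_zero_of_hessDet {K : (ℝ × ℝ) × Y → ℝ} (hK : SmoothNear K 0)
    (hdet : hessDet (eu, 0) (ev, 0) K ≠ 0) {y : ℝ × ℝ}
    (h1 : dd (y, 0) (dd (eu, 0) K) 0 = 0) (h2 : dd (y, 0) (dd (ev, 0) K) 0 = 0) : y = 0 := by
  have hz : ∀ f : (ℝ × ℝ) × Y → ℝ, dd (0, 0) f 0 = 0 := fun f => by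
    simp only [dd]; exact map_zero _
  rw [dd_add_smul, hz] at h1 h2
  rw [dd_comm hK (ev, 0) (eu, 0)] at h1
  simp only [smul_eq_mul] at h1 h2
  have e1 : y.1 * hessDet (eu, 0) (ev, 0) K = 0 := by
    rw [hessDet]
    linear_combination dd (ev, 0) (dd (ev, 0) K) 0 * h1 - dd (eu, 0) (dd (ev, 0) K) 0 * h2
  have e2 : y.2 * hessDet (eu, 0) (ev, 0) K = 0 := by
    rw [hessDet]
    linear_combination dd (eu, 0) (dd (eu, 0) K) 0 * h2 - dd (eu, 0) (dd (ev, 0) K) 0 * h1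
  ext
  · exact (mul_eq_zero.1 e1).resolve_right hdet
  · exact (mul_eq_zero.1 e2).resolve_right hdet

/-- A deformation of a function with a nondegenerate critical point has a smooth family of critical
points. -/
theorem SmoothNear.exists_critical {G : (ℝ × ℝ) × Z → ℝ} (hG : SmoothNear G 0)
    (h1 : dd (eu, 0) G 0 = 0) (h2 : dd (ev, 0) G 0 = 0)
    (hdet : hessDet (eu, 0) (ev, 0) G ≠ 0) :
    ∃ b : Z → ℝ × ℝ, SmoothNear b 0 ∧ b 0 = 0 ∧
      ∀ᶠ z in 𝓝 (0 : Z), dd (eu, 0) G (b z, z) = 0 ∧ dd (ev, 0) G (b z, z) = 0 := by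
  let H : (ℝ × ℝ) × Z → ℝ × ℝ := fun q => (dd (eu, 0) G q, dd (ev, 0) G q)
  have hH : SmoothNear H 0 := (hG.along _).prodMk (hG.along _)
  obtain ⟨b, hb, hb0, hsol, -⟩ := hH.exists_implicit (by simp [H, h1, h2]) (fun y hy => by
    have e1 := (hG.along (eu, 0)).differentiableAt.hasFDerivAt
    have e2 := (hG.along (ev, 0)).differentiableAt.hasFDerivAt
    rw [(e1.prodMk e2).fderiv] at hy
    exact eq_zero_of_hessDet hG hdet (congrArg Prod.fst hy) (congrArg Prod.snd hy))
  refine ⟨b, hb, hb0, ?_⟩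
  filter_upwards [hsol] with z hz
  exact ⟨congrArg Prod.fst hz, congrArg Prod.snd hz⟩

/-- In a versal unfolding of a nondegenerate critical point there is a critical point with a
prescribed value. -/
theorem SmoothNear.exists_critical_value {K : (ℝ × ℝ) × ℝ → ℝ} (hK : SmoothNear K 0)
    (h0 : K 0 = 0) (h1 : dd (eu, 0) K 0 = 0) (h2 : dd (ev, 0) K 0 = 0)
    (hdet : hessDet (eu, 0) (ev, 0) K ≠ 0) (ht : dd (0, 1) K 0 ≠ 0)
    {γ : Z → ℝ} (hγ : SmoothNear γ 0) (hγ0 : γ 0 = 0) :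
    ∃ (c : Z → ℝ × ℝ) (θ : Z → ℝ), SmoothNear c 0 ∧ SmoothNear θ 0 ∧ c 0 = 0 ∧ θ 0 = 0 ∧
      ∀ᶠ z in 𝓝 (0 : Z), K (c z, θ z) = γ z ∧
        dd (eu, 0) K (c z, θ z) = 0 ∧ dd (ev, 0) K (c z, θ z) = 0 := by
  let H : ((ℝ × ℝ) × ℝ) × Z → (ℝ × ℝ) × ℝ := fun q =>
    ((dd (eu, 0) K q.1, dd (ev, 0) K q.1), K q.1 - γ q.2)
  have hid : SmoothNear (fun r : ((ℝ × ℝ) × ℝ) × Z => r) 0 := smoothNear_id _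
  have s1 := (hK.along (eu, 0)).comp_of_eq hid.fst rfl
  have s2 := (hK.along (ev, 0)).comp_of_eq hid.fst rfl
  have s3 := (hK.comp_of_eq hid.fst rfl).sub (hγ.comp_of_eq hid.snd rfl)
  have hH : SmoothNear H 0 := (s1.prodMk s2).prodMk s3
  have hH0 : H 0 = 0 := by
    have : H 0 = ((dd (eu, 0) K 0, dd (ev, 0) K 0), K 0 - γ 0) := rfl
    rw [this, h1, h2, h0, hγ0]; simp
  obtain ⟨φ, hφ, hφ0, hsol, -⟩ := hH.exists_implicit hH0 (fun y hy => by
    have hd : fderiv ℝ (fun q : (ℝ × ℝ) × ℝ => H (q, 0)) 0 y = 0 := by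
      have := dd_slice (K := H) (p := 0) (t := 0) hH.differentiableAt y
      exact this.trans hy
    have e1 := (hK.along (eu, 0)).differentiableAt.hasFDerivAt
    have e2 := (hK.along (ev, 0)).differentiableAt.hasFDerivAt
    have e3 := hK.differentiableAt.hasFDerivAt.sub_const (γ 0)
    have := ((e1.prodMk e2).prodMk e3).fderiv
    change fderiv ℝ (fun q : (ℝ × ℝ) × ℝ => H (q, 0)) 0 = _ at this
    rw [this] at hd
    have d1 : dd y (dd (eu, 0) K) 0 = 0 := congrArg (fun r => r.1.1) hd
    have d2 : dd y (dd (ev, 0) K) 0 = 0 := congrArg (fun r => r.1.2) hd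
    have d3 : dd y K 0 = 0 := congrArg Prod.snd hd
    obtain ⟨p, τ⟩ := y
    have hτ : dd (0, τ) K 0 = τ * dd (0, 1) K 0 := by
      have : ((0 : ℝ × ℝ), τ) = τ • (0, 1) := by ext <;> simp
      simp only [dd]
      rw [this, map_smul, smul_eq_mul]
    rw [dd_add_smul, h1, h2, hτ] at d3
    have hτ0 : τ = 0 := by
      have : τ * dd (0, 1) K 0 = 0 := by simpa using d3
      exact (mul_eq_zero.1 this).resolve_right ht
    subst hτ0
    rw [eq_zero_of_hessDet hK hdet d1 d2]; rfl)
  refine ⟨fun z => (φ z).1, fun z => (φ z).2, hφ.fst, hφ.snd, by simp [hφ0], by simp [hφ0], ?_⟩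
  filter_upwards [hsol] with z hz
  exact ⟨sub_eq_zero.1 (congrArg Prod.snd hz), congrArg (fun r => r.1.1) hz,
    congrArg (fun r => r.1.2) hz⟩

theorem isRVersal_of_dd_ne_zero {K : (ℝ × ℝ) × ℝ → ℝ} (hK : SmoothNear K 0)
    (h0 : K 0 = 0) (h1 : dd (eu, 0) K 0 = 0) (h2 : dd (ev, 0) K 0 = 0)
    (hdet : hessDet (eu, 0) (ev, 0) K ≠ 0) (ht : dd (0, 1) K 0 ≠ 0) : IsRVersal K := by
  refine ⟨hK, fun m G hG hGK => ?_⟩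
  have hGK' : (fun p : ℝ × ℝ => G (p, 0)) =ᶠ[𝓝 0] fun p => K (p, 0) := hGK
  have hd : ∀ w : ℝ × ℝ, dd (w, 0) G 0 = dd (w, 0) K 0 := fun w =>
    (dd_slice (K := G) (p := 0) (t := 0) hG.differentiableAt w).symm.trans
      ((dd_congr_at hGK' w).trans (dd_slice (K := K) (p := 0) (t := 0) hK.differentiableAt w))
  have hGdet : hessDet (eu, 0) (ev, 0) G = hessDet (eu, 0) (ev, 0) K := by
    rw [← hessDet_slice hG, ← hessDet_slice hK, hessDet_congr hGK']
  obtain ⟨b, hb, hb0, hbG⟩ := hG.exists_critical ((hd eu).trans h1) ((hd ev).trans h2)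
    (by rwa [hGdet])
  have hbz : SmoothNear (fun z => (b z, z)) 0 := hb.prodMk (smoothNear_id _)
  have hγ : SmoothNear (fun z => G (b z, z)) 0 := hG.comp_of_eq hbz (by simp [hb0])
  have hG0 : G 0 = 0 := hGK'.eq_of_nhds.trans h0
  have hγ0 : G (b 0, 0) = 0 := by rw [hb0]; exact hG0
  obtain ⟨c, θ, hc, hθ, hc0, hθ0, hcK⟩ := hK.exists_critical_value h0 h1 h2 hdet ht hγ hγ0
  obtain ⟨α, hα, hαK, hαdet⟩ := hK.exists_quad_of_critical hc hθ hγ hc0 hθ0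
    (hcK.mono fun _ h => h.1) (hcK.mono fun _ h => h.2.1) (hcK.mono fun _ h => h.2.2)
  obtain ⟨β, hβ, hβG, -⟩ := hG.exists_quad_of_critical hb (smoothNear_id 0) hγ hb0 rfl
    (Eventually.of_forall fun _ => rfl) (hbG.mono fun _ h => h.1) (hbG.mono fun _ h => h.2)
  have hid : SmoothNear (fun q : (ℝ × ℝ) × (Fin m → ℝ) => q) 0 := smoothNear_id _
  have hpz : SmoothNear (fun q : (ℝ × ℝ) × (Fin m → ℝ) => (q.1, (0 : Fin m → ℝ))) 0 :=
    hid.fst.prodMk (smoothNear_const _ _)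
  have hpt : Tendsto (fun q : (ℝ × ℝ) × (Fin m → ℝ) => (q.1, (0 : Fin m → ℝ))) (𝓝 0) (𝓝 0) :=
    hpz.continuousAt
  -- The coefficients of the two quadratic forms are made to agree for the parameter zero.
  let β' : (ℝ × ℝ) × (Fin m → ℝ) → ℝ × ℝ × ℝ := fun q => β q - β (q.1, 0) + α (q.1, 0)
  have hβ' : SmoothNear β' 0 :=
    (hβ.sub (hβ.comp_of_eq hpz rfl)).add (hα.comp_of_eq hpz rfl)
  have hβ'G : ∀ᶠ q in 𝓝 0, G (b q.2 + q.1, q.2) = G (b q.2, q.2) + quad (β' q) q.1 := by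
    have hpp : Tendsto (fun q : (ℝ × ℝ) × (Fin m → ℝ) => q.1) (𝓝 0) (𝓝 0) :=
      hid.fst.continuousAt
    filter_upwards [hβG, hpt.eventually hβG, hpt.eventually hαK, hpp.eventually hGK]
      with q e1 e2 e3 e4
    simp only [hb0, hc0, hθ0, zero_add] at e2 e3
    rw [e1]
    have : quad (β (q.1, 0)) q.1 = quad (α (q.1, 0)) q.1 := by
      rw [e4, e3] at e2
      have e2 := add_left_cancel e2
      exact e2.symm
    have e5 : quad (β' q) q.1 = quad (β q) q.1 - quad (β (q.1, 0)) q.1 + quad (α (q.1, 0)) q.1 := by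
      simp [quad, β']; ring
    rw [e5, this]; ring
  have hα0 : quadDet (α 0) ≠ 0 := by
    intro h
    rw [h, mul_zero] at hαdet
    exact hdet hαdet
  have hαβ : ∀ p : ℝ × ℝ, α (p, 0) = β' (p, 0) := by intro p; simp [β']
  obtain ⟨M, hM, -, hMq, hM1⟩ := exists_quad_eq hα hβ' (hαβ 0) hα0
  let y : (ℝ × ℝ) × (Fin m → ℝ) → (ℝ × ℝ) × (Fin m → ℝ) := fun q => (q.1 - b q.2, q.2)
  have hy : SmoothNear y 0 := (hid.fst.sub (hb.comp_of_eq hid.snd rfl)).prodMk hid.snd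
  have hy0 : y 0 = 0 := by simp [y, hb0]
  have hyt : Tendsto y (𝓝 0) (𝓝 0) := hy.tendsto hy0
  have hN : SmoothNear (fun q : (ℝ × ℝ) × (Fin m → ℝ) => colMul (M q) q.1) 0 :=
    (ContDiff.smoothNear contDiff_colMul _).comp (hM.prodMk hid.fst)
  refine ⟨fun q => c q.2 + colMul (M (y q)) (y q).1, θ, (hc.comp_of_eq hid.snd rfl).add
    (hN.comp_of_eq hy hy0), hθ, hθ0, ?_, ?_⟩
  · have ht : Tendsto (fun p : ℝ × ℝ => (p, (0 : Fin m → ℝ))) (𝓝 0) (𝓝 0) :=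
      tendsto_prodMk_right 0 0
    filter_upwards [ht.eventually hM1] with p hp
    simp only [y, hb0, hc0, sub_zero, zero_add]
    rw [hp (hαβ p)]
    simp [colMul]
  · have hNt : Tendsto (fun q => (colMul (M (y q)) (y q).1, (y q).2)) (𝓝 0) (𝓝 0) := by
      exact ((hN.prodMk hid.snd).comp_of_eq hy hy0).tendsto (by simp [hy0, colMul])
    filter_upwards [hyt.eventually hMq, hyt.eventually hβ'G, hNt.eventually hαK] with q e1 e2 e3
    have hyq : (y q).2 = q.2 := rfl
    rw [hyq] at e1 e2 e3
    have hq : (b q.2 + (y q).1, q.2) = q := by simp [y]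
    rw [hq] at e2
    rw [e3, e2, e1]

theorem IsRVersal.dd_ne_zero {K : (ℝ × ℝ) × ℝ → ℝ} (hK : IsRVersal K)
    (h1 : dd (eu, 0) K 0 = 0) (h2 : dd (ev, 0) K 0 = 0) : dd (0, 1) K 0 ≠ 0 := by
  obtain ⟨hs, hv⟩ := hK
  have hid : SmoothNear (fun q : (ℝ × ℝ) × (Fin 1 → ℝ) => q) 0 := smoothNear_id _
  have hsl : SmoothNear (fun q : (ℝ × ℝ) × (Fin 1 → ℝ) => K (q.1, 0)) 0 :=
    hs.comp_of_eq (hid.fst.prodMk (smoothNear_const _ _)) rfl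
  have hs1 : SmoothNear (fun q : (ℝ × ℝ) × (Fin 1 → ℝ) => q.2 0) 0 :=
    ContDiff.smoothNear (by fun_prop) _
  obtain ⟨g, θ, hg, hθ, hθ0, hg0, he⟩ := hv 1 (fun q => K (q.1, 0) + q.2 0) (hsl.add hs1)
    (by simp)
  intro ht
  have hK0 : fderiv ℝ K 0 = 0 := by
    refine ContinuousLinearMap.ext fun v => ?_
    have hτ : dd (0, v.2) K 0 = v.2 * dd (0, 1) K 0 := by
      have : ((0 : ℝ × ℝ), v.2) = v.2 • (0, 1) := by ext <;> simp
      simp only [dd]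
      rw [this, map_smul, smul_eq_mul]
    change dd (v.1, v.2) K 0 = 0
    rw [dd_add_smul, h1, h2, hτ, ht]; simp
  have hι : HasDerivAt (fun r : ℝ => ((0 : ℝ × ℝ), fun _ : Fin 1 => r)) (0, fun _ => 1) 0 :=
    (hasDerivAt_const _ _).prodMk (hasDerivAt_pi.2 fun _ => hasDerivAt_id _)
  have hιc : Tendsto (fun r : ℝ => ((0 : ℝ × ℝ), fun _ : Fin 1 => r)) (𝓝 0) (𝓝 0) :=
    hι.continuousAt
  have hin : SmoothNear (fun q : (ℝ × ℝ) × (Fin 1 → ℝ) => (g q, θ q.2)) 0 :=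
    hg.prodMk (hθ.comp_of_eq hid.snd rfl)
  have hin0 : (g 0, θ (0 : (ℝ × ℝ) × (Fin 1 → ℝ)).2) = 0 := by
    have : g 0 = 0 := hg0.self_of_nhds
    rw [this, Prod.snd_zero, hθ0]; rfl
  have hKc : HasFDerivAt K (0 : (ℝ × ℝ) × ℝ →L[ℝ] ℝ) (g 0, θ (0 : (ℝ × ℝ) × (Fin 1 → ℝ)).2) := by
    rw [hin0, ← hK0]; exact hs.differentiableAt.hasFDerivAt
  have d1 : HasDerivAt (fun r : ℝ => K (g ((0 : ℝ × ℝ), fun _ : Fin 1 => r), θ fun _ => r)) 0 0 := by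
    have e1 := hKc.comp 0 hin.differentiableAt.hasFDerivAt
    rw [ContinuousLinearMap.zero_comp] at e1
    exact e1.comp_hasDerivAt (0 : ℝ) hι
  have d2 : HasDerivAt (fun r : ℝ => K (0, 0) + r) 1 0 := (hasDerivAt_id _).const_add _
  have heq : (fun r : ℝ => K (0, 0) + r) =ᶠ[𝓝 0]
      fun r : ℝ => K (g ((0 : ℝ × ℝ), fun _ : Fin 1 => r), θ fun _ => r) := by
    filter_upwards [hιc.eventually he] with r hr using hr
  have := d2.unique (d1.congr_of_eventuallyEq heq)
  exact one_ne_zero this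

end Versality

end Minkowski

namespace Minkowski

section SecondForm

/-- The determinant `⟨a × b, c⟩`. -/
def mixed (a b c : Fin 3 → ℝ) : ℝ := mink (lcross a b) c

theorem mixed_eq (a b c : Fin 3 → ℝ) : mixed a b c = (a 1 * b 2 - a 2 * b 1) * c 0 +
    (a 2 * b 0 - a 0 * b 2) * c 1 + (a 0 * b 1 - a 1 * b 0) * c 2 := by
  simp [mixed, mink, lcross]
  ring

variable {E : Type*} [NormedAddCommGroup E] [NormedSpace ℝ E]

theorem SmoothNear.apply {f : E → Fin 3 → ℝ} {a : E} (hf : SmoothNear f a) (i : Fin 3) :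
    SmoothNear (fun p => f p i) a := by
  filter_upwards [hf] with y hy using contDiffAt_pi.1 hy i

theorem SmoothNear.mixed {f g h : E → Fin 3 → ℝ} {a : E} (hf : SmoothNear f a)
    (hg : SmoothNear g a) (hh : SmoothNear h a) :
    SmoothNear (fun p => Minkowski.mixed (f p) (g p) (h p)) a := by
  simp only [mixed_eq]
  exact (((((hf.apply 1).mul (hg.apply 2)).sub ((hf.apply 2).mul (hg.apply 1))).mul
    (hh.apply 0)).add ((((hf.apply 2).mul (hg.apply 0)).sub ((hf.apply 0).mul (hg.apply 2))).mul
    (hh.apply 1))).add ((((hf.apply 0).mul (hg.apply 1)).sub ((hf.apply 1).mul (hg.apply 0))).mul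
    (hh.apply 2))

theorem exists_mixed_ne_zero {A : ℝ × ℝ →L[ℝ] Fin 3 → ℝ} (hA : Function.Injective A) :
    ∃ N, mixed (A eu) (A ev) N ≠ 0 := by
  set a := A eu with ha
  set b := A ev with hb
  by_contra! h
  have h0 := h ![1, 0, 0]
  have h1 := h ![0, 1, 0]
  have h2 := h ![0, 0, 1]
  simp [mixed_eq] at h0 h1 h2
  have hlin : ∀ s t : ℝ, s • a + t • b = 0 → s = 0 ∧ t = 0 := by
    intro s t hst
    have : A (s, t) = 0 := by
      have e : (s, t) = s • eu + t • ev := by ext <;> simp [eu, ev]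
      rw [e, map_add, map_smul, map_smul, hst]
    have := hA (this.trans (map_zero A).symm)
    exact Prod.mk_eq_zero.1 this
  have hpar : ∀ i, b i • a + (-a i) • b = 0 := by
    intro i
    funext j
    fin_cases i <;> fin_cases j <;> simp <;> linarith
  have ha0 : a = 0 := by
    funext i
    simpa using (hlin _ _ (hpar i)).2
  have := hlin 1 0 (by simp [ha0])
  exact one_ne_zero this.1

/-- The coefficient of the second fundamental form of the surface spanned by `e₁`, `e₂` in the
directions `v`, `w`. -/
noncomputable def sff (e₁ e₂ v w : E) (X : E → Fin 3 → ℝ) (p : E) : ℝ :=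
  mixed (dd e₁ X p) (dd e₂ X p) (dd v (dd w X) p)

/-- The determinant of the second fundamental form. -/
noncomputable def sffDet (e₁ e₂ : E) (X : E → Fin 3 → ℝ) (p : E) : ℝ :=
  sff e₁ e₂ e₁ e₁ X p * sff e₁ e₂ e₂ e₂ X p - sff e₁ e₂ e₂ e₁ X p ^ 2

theorem Kbar_eq_sffDet (x : ℝ × ℝ → Fin 3 → ℝ) : Kbar x = sffDet eu ev x := rfl

theorem SmoothNear.sff {X : E → Fin 3 → ℝ} {a : E} (hX : SmoothNear X a) (e₁ e₂ v w : E) :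
    SmoothNear (sff e₁ e₂ v w X) a :=
  (hX.along _).mixed (hX.along _) ((hX.along _).along _)

theorem SmoothNear.sffDet {X : E → Fin 3 → ℝ} {a : E} (hX : SmoothNear X a) (e₁ e₂ : E) :
    SmoothNear (sffDet e₁ e₂ X) a :=
  ((hX.sff _ _ _ _).mul (hX.sff _ _ _ _)).sub ((hX.sff _ _ _ _).pow 2)

theorem sffDet_congr {X Y : E → Fin 3 → ℝ} {a : E} (h : X =ᶠ[𝓝 a] Y) (e₁ e₂ : E) :
    sffDet e₁ e₂ X =ᶠ[𝓝 a] sffDet e₁ e₂ Y := by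
  filter_upwards [h.eventuallyEq_nhds] with p hp
  simp only [sffDet, sff, dd_congr_at hp, dd_congr_at₂ hp]

theorem sffDet_slice {X : (ℝ × ℝ) × ℝ → Fin 3 → ℝ} {p : ℝ × ℝ} {t : ℝ}
    (hX : SmoothNear X (p, t)) :
    Kbar (fun p => X (p, t)) p = sffDet (eu, 0) (ev, 0) X (p, t) := by
  rw [Kbar_eq_sffDet]
  simp only [sffDet, sff, dd_slice hX.differentiableAt, dd_dd_slice hX]

section Reparametrization

variable {F : Type*} [NormedAddCommGroup F] [NormedSpace ℝ F]

theorem dd_smul_at {f : E → ℝ} {g : E → F} {a : E} (hf : SmoothNear f a) (hg : SmoothNear g a)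
    (v : E) : dd v (fun p => f p • g p) a = dd v f a • g a + f a • dd v g a := by
  simp only [dd]
  rw [fderiv_fun_smul hf.differentiableAt hg.differentiableAt]
  simp [add_comm]

theorem SmoothNear.smul {f : E → ℝ} {g : E → F} {a : E} (hf : SmoothNear f a)
    (hg : SmoothNear g a) : SmoothNear (fun y => f y • g y) a := by
  filter_upwards [hf, hg] with y h1 h2 using h1.smul h2

theorem dd_dd_comp {f : ℝ × ℝ → F} {h : ℝ × ℝ → ℝ × ℝ} {p : ℝ × ℝ} (hf : SmoothNear f (h p))
    (hh : SmoothNear h p) (v w : ℝ × ℝ) :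
    dd v (dd w fun q => f (h q)) p =
      dd v (dd w fun q => (h q).1) p • dd eu f (h p) +
      dd w (fun q => (h q).1) p • (dd v (fun q => (h q).1) p • dd eu (dd eu f) (h p) +
        dd v (fun q => (h q).2) p • dd ev (dd eu f) (h p)) +
      (dd v (dd w fun q => (h q).2) p • dd ev f (h p) +
      dd w (fun q => (h q).2) p • (dd v (fun q => (h q).1) p • dd ev (dd eu f) (h p) +
        dd v (fun q => (h q).2) p • dd ev (dd ev f) (h p))) := by
  have s1 := (hf.along eu).comp hh
  have s2 := (hf.along ev).comp hh
  rw [dd_congr_at (dd_comp hf hh w),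
    dd_add_at ((hh.fst.along w).smul s1) ((hh.snd.along w).smul s2),
    dd_smul_at (hh.fst.along w) s1, dd_smul_at (hh.snd.along w) s2,
    dd_comp_at (hf.along eu) hh, dd_comp_at (hf.along ev) hh, dd_comm hf eu ev]

theorem sff_comp {x : ℝ × ℝ → Fin 3 → ℝ} {h : ℝ × ℝ → ℝ × ℝ} {p : ℝ × ℝ}
    (hx : SmoothNear x (h p)) (hh : SmoothNear h p) (v w : ℝ × ℝ) :
    sff eu ev v w (fun q => x (h q)) p = jac h p *
      (dd v (fun q => (h q).1) p * dd w (fun q => (h q).1) p * sff eu ev eu eu x (h p) +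
      (dd v (fun q => (h q).1) p * dd w (fun q => (h q).2) p +
        dd v (fun q => (h q).2) p * dd w (fun q => (h q).1) p) * sff eu ev ev eu x (h p) +
      dd v (fun q => (h q).2) p * dd w (fun q => (h q).2) p * sff eu ev ev ev x (h p)) := by
  rw [sff, dd_comp_at hx hh, dd_comp_at hx hh, dd_dd_comp hx hh]
  simp only [sff, jac]
  generalize dd eu x (h p) = a
  generalize dd ev x (h p) = b
  generalize dd eu (dd eu x) (h p) = c
  generalize dd ev (dd eu x) (h p) = d
  generalize dd ev (dd ev x) (h p) = e
  simp only [mixed_eq, Pi.add_apply, Pi.smul_apply, smul_eq_mul]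
  ring

theorem Kbar_comp {x : ℝ × ℝ → Fin 3 → ℝ} {h : ℝ × ℝ → ℝ × ℝ} {p : ℝ × ℝ}
    (hx : SmoothNear x (h p)) (hh : SmoothNear h p) :
    Kbar (fun q => x (h q)) p = jac h p ^ 4 * Kbar x (h p) := by
  rw [Kbar_eq_sffDet, Kbar_eq_sffDet]
  simp only [sffDet, sff_comp hx hh]
  simp only [jac]
  ring

end Reparametrization

section Perturbation

/-- The variation of the second fundamental form when `X` is moved by `ψ N`. -/
noncomputable def sffVar (e₁ e₂ v w : E) (X : E → Fin 3 → ℝ) (N : Fin 3 → ℝ) (ψ : E → ℝ)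
    (p : E) : ℝ :=
  dd v (dd w ψ) p * mixed (dd e₁ X p) (dd e₂ X p) N +
    (dd e₁ ψ p * mixed N (dd e₂ X p) (dd v (dd w X) p) +
      dd e₂ ψ p * mixed (dd e₁ X p) N (dd v (dd w X) p))

theorem SmoothNear.sffVar {X : E → Fin 3 → ℝ} {ψ : E → ℝ} {a : E} (hX : SmoothNear X a)
    (hψ : SmoothNear ψ a) (N : Fin 3 → ℝ) (e₁ e₂ v w : E) :
    SmoothNear (sffVar e₁ e₂ v w X N ψ) a := by
  have hN : SmoothNear (fun _ : E => N) a := smoothNear_const _ _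
  have h2 := (hX.along w).along v
  exact (((hψ.along w).along v).mul ((hX.along e₁).mixed (hX.along e₂) hN)).add
    (((hψ.along e₁).mul (hN.mixed (hX.along e₂) h2)).add
      ((hψ.along e₂).mul ((hX.along e₁).mixed hN h2)))

theorem dd_smul_smul_const {ψ : E → ℝ} {p : E} (hψ : SmoothNear ψ p) (N : Fin 3 → ℝ) (ε : ℝ)
    (v : E) : dd v (fun q => ε • ψ q • N) p = ε • dd v ψ p • N := by
  rw [dd_smul_at (smoothNear_const ε p) (hψ.smul (smoothNear_const N p)),
    dd_smul_at hψ (smoothNear_const N p), dd_const, dd_const]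
  simp

theorem SmoothNear.smul_smul_const {ψ : E → ℝ} {p : E} (hψ : SmoothNear ψ p) (N : Fin 3 → ℝ)
    (ε : ℝ) : SmoothNear (fun q => ε • ψ q • N) p :=
  (smoothNear_const ε _).smul (hψ.smul (smoothNear_const N _))

theorem dd_perturb {X : E → Fin 3 → ℝ} {ψ : E → ℝ} {p : E} (hX : SmoothNear X p)
    (hψ : SmoothNear ψ p) (N : Fin 3 → ℝ) (ε : ℝ) (v : E) :
    dd v (fun q => X q + ε • ψ q • N) p = dd v X p + ε • dd v ψ p • N := by
  rw [dd_add_at hX (hψ.smul_smul_const N ε), dd_smul_smul_const hψ]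

theorem sff_perturb {X : E → Fin 3 → ℝ} {ψ : E → ℝ} {p : E} (hX : SmoothNear X p)
    (hψ : SmoothNear ψ p) (N : Fin 3 → ℝ) (ε : ℝ) (e₁ e₂ v w : E) :
    sff e₁ e₂ v w (fun q => X q + ε • ψ q • N) p =
      sff e₁ e₂ v w X p + ε * sffVar e₁ e₂ v w X N ψ p := by
  have h2 : dd v (dd w (fun q => X q + ε • ψ q • N)) p =
      dd v (dd w X) p + ε • dd v (dd w ψ) p • N := by
    have : dd w (fun q => X q + ε • ψ q • N) =ᶠ[𝓝 p] fun q => dd w X q + ε • dd w ψ q • N := by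
      filter_upwards [hX.eventually_smoothNear, hψ.eventually_smoothNear] with q h1 h2
      exact dd_perturb h1 h2 N ε w
    rw [dd_congr_at this, dd_perturb (hX.along w) (hψ.along w)]
  simp only [sff, sffVar, dd_perturb hX hψ, h2]
  generalize dd e₁ X p = a
  generalize dd e₂ X p = b
  generalize dd v (dd w X) p = c
  simp only [mixed_eq, Pi.add_apply, Pi.smul_apply, smul_eq_mul]
  ring

/-- The first-order variation of `sffDet`. -/
noncomputable def detVar (e₁ e₂ : E) (X : E → Fin 3 → ℝ) (N : Fin 3 → ℝ) (ψ : E → ℝ)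
    (p : E) : ℝ :=
  sff e₁ e₂ e₁ e₁ X p * sffVar e₁ e₂ e₂ e₂ X N ψ p + sff e₁ e₂ e₂ e₂ X p *
    sffVar e₁ e₂ e₁ e₁ X N ψ p - 2 * (sff e₁ e₂ e₂ e₁ X p * sffVar e₁ e₂ e₂ e₁ X N ψ p)

/-- The second-order variation of `sffDet`. -/
noncomputable def detVar₂ (e₁ e₂ : E) (X : E → Fin 3 → ℝ) (N : Fin 3 → ℝ) (ψ : E → ℝ)
    (p : E) : ℝ :=
  sffVar e₁ e₂ e₁ e₁ X N ψ p * sffVar e₁ e₂ e₂ e₂ X N ψ p -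
    sffVar e₁ e₂ e₂ e₁ X N ψ p * sffVar e₁ e₂ e₂ e₁ X N ψ p

theorem sffDet_perturb {X : E → Fin 3 → ℝ} {ψ : E → ℝ} {p : E} (hX : SmoothNear X p)
    (hψ : SmoothNear ψ p) (N : Fin 3 → ℝ) (ε : ℝ) (e₁ e₂ : E) :
    sffDet e₁ e₂ (fun q => X q + ε • ψ q • N) =ᶠ[𝓝 p] fun q =>
      sffDet e₁ e₂ X q + (ε * detVar e₁ e₂ X N ψ q + ε ^ 2 * detVar₂ e₁ e₂ X N ψ q) := by
  filter_upwards [hX.eventually_smoothNear, hψ.eventually_smoothNear] with q h1 h2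
  simp only [sffDet, sff_perturb h1 h2, detVar, detVar₂]
  ring

end Perturbation

end SecondForm

end Minkowski

namespace Minkowski

section Variation

variable {E : Type*} [NormedAddCommGroup E] [NormedSpace ℝ E]
  {X : E → Fin 3 → ℝ} {ψ : E → ℝ} {N : Fin 3 → ℝ} {e₁ e₂ : E}

theorem sffVar_eq_zero {v w p : E} (h1 : dd e₁ ψ p = 0) (h2 : dd e₂ ψ p = 0)
    (hvw : dd v (dd w ψ) p = 0) : sffVar e₁ e₂ v w X N ψ p = 0 := by
  simp [sffVar, h1, h2, hvw]

theorem dd_sffVar {v w p : E} (hX : SmoothNear X p) (hψ : SmoothNear ψ p)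
    (h1 : dd e₁ ψ p = 0) (h2 : dd e₂ ψ p = 0) (hvw : dd v (dd w ψ) p = 0) {c : E}
    (hc1 : dd c (dd e₁ ψ) p = 0) (hc2 : dd c (dd e₂ ψ) p = 0) :
    dd c (sffVar e₁ e₂ v w X N ψ) p =
      dd c (dd v (dd w ψ)) p * mixed (dd e₁ X p) (dd e₂ X p) N := by
  have hN : SmoothNear (fun _ : E => N) p := smoothNear_const _ _
  have s2 := (hX.along w).along v
  have a1 := (hX.along e₁).mixed (hX.along e₂) hN
  have a2 := hN.mixed (hX.along e₂) s2
  have a3 := (hX.along e₁).mixed hN s2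
  have b1 := ((hψ.along w).along v)
  have b2 := hψ.along e₁
  have b3 := hψ.along e₂
  unfold sffVar
  rw [dd_add_at (b1.mul a1) ((b2.mul a2).add (b3.mul a3)), dd_add_at (b2.mul a2) (b3.mul a3),
    dd_mul_at b1 a1, dd_mul_at b2 a2, dd_mul_at b3 a3, h1, h2, hvw, hc1, hc2]
  ring

theorem dd_dd_sffVar {v w p : E} (hX : SmoothNear X p) (hψ : SmoothNear ψ p)
    (h1 : dd e₁ ψ p = 0) (h2 : dd e₂ ψ p = 0) (hvw : dd v (dd w ψ) p = 0)
    (hc1 : ∀ c, dd c (dd e₁ ψ) p = 0) (hc2 : ∀ c, dd c (dd e₂ ψ) p = 0)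
    (hcvw : ∀ c, dd c (dd v (dd w ψ)) p = 0)
    (hcd1 : ∀ c d, dd c (dd d (dd e₁ ψ)) p = 0) (hcd2 : ∀ c d, dd c (dd d (dd e₂ ψ)) p = 0)
    (c d : E) :
    dd c (dd d (sffVar e₁ e₂ v w X N ψ)) p =
      dd c (dd d (dd v (dd w ψ))) p * mixed (dd e₁ X p) (dd e₂ X p) N := by
  have hN : SmoothNear (fun _ : E => N) p := smoothNear_const _ _
  have s2 := (hX.along w).along v
  have a1 := (hX.along e₁).mixed (hX.along e₂) hN
  have a2 := hN.mixed (hX.along e₂) s2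
  have a3 := (hX.along e₁).mixed hN s2
  have b1 := ((hψ.along w).along v)
  have b2 := hψ.along e₁
  have b3 := hψ.along e₂
  unfold sffVar
  rw [dd_add_at₂ (b1.mul a1) ((b2.mul a2).add (b3.mul a3)), dd_add_at₂ (b2.mul a2) (b3.mul a3),
    dd_mul_at₂ b1 a1, dd_mul_at₂ b2 a2, dd_mul_at₂ b3 a3, h1, h2, hvw]
  simp only [hc1, hc2, hcvw, hcd1, hcd2]
  ring

theorem SmoothNear.detVar {p : E} (hX : SmoothNear X p) (hψ : SmoothNear ψ p) (N : Fin 3 → ℝ)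
    (e₁ e₂ : E) : SmoothNear (detVar e₁ e₂ X N ψ) p :=
  (((hX.sff _ _ _ _).mul (hX.sffVar hψ _ _ _ _ _)).add
    ((hX.sff _ _ _ _).mul (hX.sffVar hψ _ _ _ _ _))).sub
    ((smoothNear_const _ _).mul ((hX.sff _ _ _ _).mul (hX.sffVar hψ _ _ _ _ _)))

theorem SmoothNear.detVar₂ {p : E} (hX : SmoothNear X p) (hψ : SmoothNear ψ p) (N : Fin 3 → ℝ)
    (e₁ e₂ : E) : SmoothNear (detVar₂ e₁ e₂ X N ψ) p :=
  ((hX.sffVar hψ _ _ _ _ _).mul (hX.sffVar hψ _ _ _ _ _)).sub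
    ((hX.sffVar hψ _ _ _ _ _).mul (hX.sffVar hψ _ _ _ _ _))

theorem dd_mul_of_right {f g : E → ℝ} {a : E} (hf : SmoothNear f a) (hg : SmoothNear g a)
    (h0 : g a = 0) (v : E) : dd v (fun p => f p * g p) a = f a * dd v g a := by
  rw [dd_mul_at hf hg, h0]; ring

theorem dd_detVar {p : E} (hX : SmoothNear X p) (hψ : SmoothNear ψ p)
    (h1 : sffVar e₁ e₂ e₁ e₁ X N ψ p = 0) (h2 : sffVar e₁ e₂ e₂ e₂ X N ψ p = 0)
    (h3 : sffVar e₁ e₂ e₂ e₁ X N ψ p = 0) (c : E) :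
    dd c (detVar e₁ e₂ X N ψ) p =
      sff e₁ e₂ e₁ e₁ X p * dd c (sffVar e₁ e₂ e₂ e₂ X N ψ) p +
      sff e₁ e₂ e₂ e₂ X p * dd c (sffVar e₁ e₂ e₁ e₁ X N ψ) p -
      2 * (sff e₁ e₂ e₂ e₁ X p * dd c (sffVar e₁ e₂ e₂ e₁ X N ψ) p) := by
  have s : ∀ v w, SmoothNear (sff e₁ e₂ v w X) p := fun v w => hX.sff _ _ _ _
  have t : ∀ v w, SmoothNear (sffVar e₁ e₂ v w X N ψ) p := fun v w => hX.sffVar hψ _ _ _ _ _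
  have hc : SmoothNear (fun _ : E => (2 : ℝ)) p := smoothNear_const _ _
  have t1 := (s e₁ e₁).mul (t e₂ e₂)
  have t2 := (s e₂ e₂).mul (t e₁ e₁)
  have t3 := (s e₂ e₁).mul (t e₂ e₁)
  unfold detVar
  rw [dd_sub_at (t1.add t2) (hc.mul t3), dd_add_at t1 t2, dd_mul_at hc t3, dd_const,
    dd_mul_of_right (s _ _) (t _ _) h1, dd_mul_of_right (s _ _) (t _ _) h2,
    dd_mul_of_right (s _ _) (t _ _) h3]
  ring

theorem detVar_eq_zero {p : E}
    (h1 : sffVar e₁ e₂ e₁ e₁ X N ψ p = 0) (h2 : sffVar e₁ e₂ e₂ e₂ X N ψ p = 0)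
    (h3 : sffVar e₁ e₂ e₂ e₁ X N ψ p = 0) : detVar e₁ e₂ X N ψ p = 0 := by
  simp [detVar, h1, h2, h3]

theorem detVar₂_eq_zero {p : E}
    (h1 : sffVar e₁ e₂ e₁ e₁ X N ψ p = 0)
    (h3 : sffVar e₁ e₂ e₂ e₁ X N ψ p = 0) : detVar₂ e₁ e₂ X N ψ p = 0 := by
  simp [detVar₂, h1, h3]

theorem dd_detVar₂ {p : E} (hX : SmoothNear X p) (hψ : SmoothNear ψ p)
    (h1 : sffVar e₁ e₂ e₁ e₁ X N ψ p = 0) (h2 : sffVar e₁ e₂ e₂ e₂ X N ψ p = 0)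
    (h3 : sffVar e₁ e₂ e₂ e₁ X N ψ p = 0) (c : E) :
    dd c (detVar₂ e₁ e₂ X N ψ) p = 0 := by
  have t : ∀ v w, SmoothNear (sffVar e₁ e₂ v w X N ψ) p := fun v w => hX.sffVar hψ _ _ _ _ _
  unfold detVar₂
  rw [dd_sub_at ((t _ _).mul (t _ _)) ((t _ _).mul (t _ _)), dd_mul_at (t _ _) (t _ _),
    dd_mul_at (t _ _) (t _ _), h1, h2, h3]
  ring

theorem dd_dd_detVar₂ {p : E} (hX : SmoothNear X p) (hψ : SmoothNear ψ p)
    (h1 : sffVar e₁ e₂ e₁ e₁ X N ψ p = 0) (h2 : sffVar e₁ e₂ e₂ e₂ X N ψ p = 0)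
    (h3 : sffVar e₁ e₂ e₂ e₁ X N ψ p = 0) (c d : E) :
    dd c (dd d (detVar₂ e₁ e₂ X N ψ)) p =
      dd d (sffVar e₁ e₂ e₁ e₁ X N ψ) p * dd c (sffVar e₁ e₂ e₂ e₂ X N ψ) p +
      dd c (sffVar e₁ e₂ e₁ e₁ X N ψ) p * dd d (sffVar e₁ e₂ e₂ e₂ X N ψ) p -
      2 * (dd c (sffVar e₁ e₂ e₂ e₁ X N ψ) p * dd d (sffVar e₁ e₂ e₂ e₁ X N ψ) p) := by
  have t : ∀ v w, SmoothNear (sffVar e₁ e₂ v w X N ψ) p := fun v w => hX.sffVar hψ _ _ _ _ _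
  unfold detVar₂
  rw [dd_sub_at₂ ((t _ _).mul (t _ _)) ((t _ _).mul (t _ _)), dd_mul_at₂ (t _ _) (t _ _),
    dd_mul_at₂ (t _ _) (t _ _), h1, h2, h3]
  ring

theorem dd_dd_detVar {p : E} (hX : SmoothNear X p) (hψ : SmoothNear ψ p)
    (h1 : sffVar e₁ e₂ e₁ e₁ X N ψ p = 0) (h2 : sffVar e₁ e₂ e₂ e₂ X N ψ p = 0)
    (h3 : sffVar e₁ e₂ e₂ e₁ X N ψ p = 0)
    (d1 : ∀ c, dd c (sffVar e₁ e₂ e₁ e₁ X N ψ) p = 0)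
    (d2 : ∀ c, dd c (sffVar e₁ e₂ e₂ e₂ X N ψ) p = 0)
    (d3 : ∀ c, dd c (sffVar e₁ e₂ e₂ e₁ X N ψ) p = 0) (c d : E) :
    dd c (dd d (detVar e₁ e₂ X N ψ)) p =
      sff e₁ e₂ e₁ e₁ X p * dd c (dd d (sffVar e₁ e₂ e₂ e₂ X N ψ)) p +
      sff e₁ e₂ e₂ e₂ X p * dd c (dd d (sffVar e₁ e₂ e₁ e₁ X N ψ)) p -
      2 * (sff e₁ e₂ e₂ e₁ X p * dd c (dd d (sffVar e₁ e₂ e₂ e₁ X N ψ)) p) := by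
  have s : ∀ v w, SmoothNear (sff e₁ e₂ v w X) p := fun v w => hX.sff _ _ _ _
  have t : ∀ v w, SmoothNear (sffVar e₁ e₂ v w X N ψ) p := fun v w => hX.sffVar hψ _ _ _ _ _
  have hc : SmoothNear (fun _ : E => (2 : ℝ)) p := smoothNear_const _ _
  have t1 := (s e₁ e₁).mul (t e₂ e₂)
  have t2 := (s e₂ e₂).mul (t e₁ e₁)
  have t3 := (s e₂ e₁).mul (t e₂ e₁)
  have hcc : dd c (dd d fun _ : E => (2 : ℝ)) p = 0 := by
    have : dd d (fun _ : E => (2 : ℝ)) = fun _ => 0 := funext fun q => dd_const d 2 q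
    rw [this, dd_const]
  unfold detVar
  rw [dd_sub_at₂ (t1.add t2) (hc.mul t3), dd_add_at₂ t1 t2, dd_mul_at₂ hc t3, dd_const, dd_const,
    hcc, dd_mul_at₂ (s _ _) (t _ _), dd_mul_at₂ (s _ _) (t _ _), dd_mul_at₂ (s _ _) (t _ _),
    h1, h2, h3]
  simp only [d1, d2, d3]
  ring

end Variation

section Polynomials

theorem dd_eu_eq_deriv {f : ℝ × ℝ → ℝ} {p : ℝ × ℝ} (hf : DifferentiableAt ℝ f p) :
    dd eu f p = deriv (fun t => f (t, p.2)) p.1 := by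
  have h1 : HasDerivAt (fun t : ℝ => (t, p.2)) eu p.1 :=
    (hasDerivAt_id _).prodMk (hasDerivAt_const _ _)
  exact (hf.hasFDerivAt.comp_hasDerivAt p.1 h1).deriv.symm

theorem dd_ev_eq_deriv {f : ℝ × ℝ → ℝ} {p : ℝ × ℝ} (hf : DifferentiableAt ℝ f p) :
    dd ev f p = deriv (fun t => f (p.1, t)) p.2 := by
  have h1 : HasDerivAt (fun t : ℝ => (p.1, t)) ev p.2 :=
    (hasDerivAt_const _ _).prodMk (hasDerivAt_id _)
  exact (hf.hasFDerivAt.comp_hasDerivAt p.2 h1).deriv.symm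

theorem deriv_quartic_polynomial (a b c d e t : ℝ) :
    deriv (fun t => a + b * t + c * t ^ 2 + d * t ^ 3 + e * t ^ 4) t =
      b + 2 * c * t + 3 * d * t ^ 2 + 4 * e * t ^ 3 := by
  have h := hasDerivAt_id t
  have := ((((h.const_mul b).const_add a).fun_add ((h.fun_pow 2).const_mul c)).fun_add
    ((h.fun_pow 3).const_mul d)).fun_add ((h.fun_pow 4).const_mul e)
  refine this.deriv.trans ?_
  simp
  ring

/-- The cubic form `u³ + v³`. -/
def cubic (p : ℝ × ℝ) : ℝ := p.1 ^ 3 + p.2 ^ 3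

/-- The quartic form `u⁴ + u²v² + v⁴`. -/
def quartic (p : ℝ × ℝ) : ℝ := p.1 ^ 4 + p.1 ^ 2 * p.2 ^ 2 + p.2 ^ 4

theorem contDiff_cubic : ContDiff ℝ ∞ cubic := by unfold cubic; fun_prop

theorem contDiff_quartic : ContDiff ℝ ∞ quartic := by unfold quartic; fun_prop

theorem dd_eu_cubic : dd eu cubic = quad (3, 0, 0) := by
  funext p
  rw [dd_eu_eq_deriv (contDiff_cubic.differentiable (by simp) _)]
  simp [cubic, quad]

theorem dd_ev_cubic : dd ev cubic = quad (0, 0, 3) := by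
  funext p
  rw [dd_ev_eq_deriv (contDiff_cubic.differentiable (by simp) _)]
  simp [cubic, quad]

theorem dd_eu_quartic : dd eu quartic = fun p => p.1 * quad (4, 0, 2) p := by
  funext p
  rw [dd_eu_eq_deriv (contDiff_quartic.differentiable (by simp) _)]
  rw [show (fun t : ℝ => quartic (t, p.2)) = fun t => p.2 ^ 4 + 0 * t + p.2 ^ 2 * t ^ 2 +
      0 * t ^ 3 + 1 * t ^ 4 from by funext t; simp only [quartic]; ring,
    deriv_quartic_polynomial]
  simp only [quad]
  ring

theorem dd_ev_quartic : dd ev quartic = fun p => p.2 * quad (2, 0, 4) p := by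
  funext p
  rw [dd_ev_eq_deriv (contDiff_quartic.differentiable (by simp) _)]
  rw [show (fun t : ℝ => quartic (p.1, t)) = fun t => p.1 ^ 4 + 0 * t + p.1 ^ 2 * t ^ 2 +
      0 * t ^ 3 + 1 * t ^ 4 from by funext t; simp only [quartic]; ring,
    deriv_quartic_polynomial]
  simp only [quad]
  ring

theorem dd_eu_eu_quartic : dd eu (dd eu quartic) = quad (12, 0, 2) := by
  rw [dd_eu_quartic]
  funext p
  rw [dd_eu_eq_deriv (by unfold quad; fun_prop)]
  rw [show (fun t : ℝ => (t, p.2).1 * quad (4, 0, 2) (t, p.2)) = fun t => 0 + 2 * p.2 ^ 2 * t + 0 * t ^ 2 +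
      4 * t ^ 3 + 0 * t ^ 4 from by funext t; simp only [quad]; ring,
    deriv_quartic_polynomial]
  simp only [quad]
  ring

theorem dd_ev_ev_quartic : dd ev (dd ev quartic) = quad (2, 0, 12) := by
  rw [dd_ev_quartic]
  funext p
  rw [dd_ev_eq_deriv (by unfold quad; fun_prop)]
  rw [show (fun t : ℝ => (p.1, t).2 * quad (2, 0, 4) (p.1, t)) = fun t => 0 + 2 * p.1 ^ 2 * t + 0 * t ^ 2 +
      4 * t ^ 3 + 0 * t ^ 4 from by funext t; simp only [quad]; ring,
    deriv_quartic_polynomial]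
  simp only [quad]
  ring

theorem dd_ev_eu_quartic : dd ev (dd eu quartic) = quad (0, 2, 0) := by
  rw [dd_eu_quartic]
  funext p
  rw [dd_ev_eq_deriv (by unfold quad; fun_prop)]
  rw [show (fun t : ℝ => (p.1, t).1 * quad (4, 0, 2) (p.1, t)) = fun t => 4 * p.1 ^ 3 + 0 * t + 2 * p.1 * t ^ 2 +
      0 * t ^ 3 + 0 * t ^ 4 from by funext t; simp only [quad]; ring,
    deriv_quartic_polynomial]
  simp only [quad]
  ring

theorem quad_zero (a : ℝ × ℝ × ℝ) : quad a 0 = 0 := by simp [quad]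

theorem eventually_polynomial_ne_zero {d₀ d₁ d₂ d₃ d₄ : ℝ}
    (h : d₄ ≠ 0 ∨ d₄ = 0 ∧ d₃ = 0 ∧ d₂ ≠ 0) :
    ∀ᶠ t in 𝓝[≠] (0 : ℝ), d₀ + d₁ * t + d₂ * t ^ 2 + d₃ * t ^ 3 + d₄ * t ^ 4 ≠ 0 := by
  open Polynomial in
  let P : ℝ[X] := C d₀ + C d₁ * X + C d₂ * X ^ 2 + C d₃ * X ^ 3 + C d₄ * X ^ 4
  have hP : ∀ t, P.eval t = d₀ + d₁ * t + d₂ * t ^ 2 + d₃ * t ^ 3 + d₄ * t ^ 4 := by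
    intro t; simp [P]
  have hP0 : P ≠ 0 := by
    intro h0
    have e : ∀ t : ℝ, d₀ + d₁ * t + d₂ * t ^ 2 + d₃ * t ^ 3 + d₄ * t ^ 4 = 0 := by
      intro t; rw [← hP, h0]; simp
    have e0 := e 0
    have e1 := e 1
    have e2 := e (-1)
    have e3 := e 2
    have e4 := e (-2)
    rcases h with h | ⟨h4, h3, h2⟩
    · apply h; linarith
    · apply h2; subst h4; subst h3; linarith
  have hfin : {t : ℝ | P.eval t = 0}.Finite := by
    refine (P.roots.toFinset.finite_toSet).subset fun t ht => ?_
    simpa [hP0] using ht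
  filter_upwards [nhdsNE_le_cofinite (0 : ℝ) hfin.compl_mem_cofinite] with t ht
  rw [← hP]; exact ht

end Polynomials

section Perturbations

variable {x : ℝ × ℝ → Fin 3 → ℝ} {N : Fin 3 → ℝ}

/-- The perturbation of a singular point of the parabolic curve in a direction `ψ N` whose
variations vanish to first order. -/
theorem perturb_singular {ψ : ℝ × ℝ → ℝ} (hx : SmoothNear x 0) (hψ : SmoothNear ψ 0)
    (h0 : Kbar x 0 = 0) (h1 : dd eu (Kbar x) 0 = 0) (h2 : dd ev (Kbar x) 0 = 0)
    (v1 : detVar eu ev x N ψ 0 = 0) (v2 : detVar₂ eu ev x N ψ 0 = 0)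
    (d1 : ∀ c, dd c (detVar eu ev x N ψ) 0 = 0) (d2 : ∀ c, dd c (detVar₂ eu ev x N ψ) 0 = 0)
    (hdet : hessDet eu ev (detVar₂ eu ev x N ψ) ≠ 0 ∨
      (∀ c d, dd c (dd d (detVar₂ eu ev x N ψ)) 0 = 0) ∧ hessDet eu ev (detVar eu ev x N ψ) ≠ 0) :
    (∀ ε : ℝ, Kbar (fun q => x q + ε • ψ q • N) 0 = 0 ∧
      dd eu (Kbar (fun q => x q + ε • ψ q • N)) 0 = 0 ∧
      dd ev (Kbar (fun q => x q + ε • ψ q • N)) 0 = 0) ∧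
    ∀ᶠ ε in 𝓝[≠] (0 : ℝ), hessDet eu ev (Kbar (fun q => x q + ε • ψ q • N)) ≠ 0 := by
  rw [Kbar_eq_sffDet] at h0 h1 h2
  simp only [Kbar_eq_sffDet]
  have hexp := fun ε : ℝ => sffDet_perturb hx hψ N ε eu ev
  have s0 := hx.sffDet eu ev
  have s1 := hx.detVar hψ N eu ev
  have s2 := hx.detVar₂ hψ N eu ev
  have hc : ∀ c : ℝ, SmoothNear (fun _ : ℝ × ℝ => c) 0 := fun c => smoothNear_const _ _
  have hmul : ∀ (c : ℝ) {f : ℝ × ℝ → ℝ}, SmoothNear f 0 → ∀ v,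
      dd v (fun p => c * f p) =ᶠ[𝓝 0] fun p => c * dd v f p := by
    intro c f hf v
    filter_upwards [hf.eventually_smoothNear] with p hp
    rw [dd_mul_at (smoothNear_const _ _) hp, dd_const]; ring
  have t1 := fun ε : ℝ => (hc ε).mul s1
  have t2 := fun ε : ℝ => (hc (ε ^ 2)).mul s2
  have first : ∀ (ε : ℝ) v, dd v (sffDet eu ev fun q => x q + ε • ψ q • N) 0 =
      dd v (sffDet eu ev x) 0 := by
    intro ε v
    rw [dd_congr_at (hexp ε), dd_add_at s0 ((t1 ε).add (t2 ε)), dd_add_at (t1 ε) (t2 ε),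
      (hmul ε s1 v).eq_of_nhds, (hmul (ε ^ 2) s2 v).eq_of_nhds, d1, d2]
    ring
  have second : ∀ (ε : ℝ) v w, dd v (dd w (sffDet eu ev fun q => x q + ε • ψ q • N)) 0 =
      dd v (dd w (sffDet eu ev x)) 0 + (ε * dd v (dd w (detVar eu ev x N ψ)) 0 +
        ε ^ 2 * dd v (dd w (detVar₂ eu ev x N ψ)) 0) := by
    intro ε v w
    rw [dd_congr_at₂ (hexp ε), dd_add_at₂ s0 ((t1 ε).add (t2 ε)), dd_add_at₂ (t1 ε) (t2 ε),
      dd_congr_at (hmul ε s1 w), dd_congr_at (hmul (ε ^ 2) s2 w),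
      (hmul ε (s1.along w) v).eq_of_nhds, (hmul (ε ^ 2) (s2.along w) v).eq_of_nhds]
  refine ⟨fun ε => ⟨?_, by rw [first, h1], by rw [first, h2]⟩, ?_⟩
  · rw [(hexp ε).eq_of_nhds, h0, v1, v2]; ring
  · simp only [hessDet, second] at hdet ⊢
    generalize dd eu (dd eu (sffDet eu ev x)) 0 = a0
    generalize dd eu (dd ev (sffDet eu ev x)) 0 = b0
    generalize dd ev (dd ev (sffDet eu ev x)) 0 = c0
    generalize ha1 : dd eu (dd eu (detVar eu ev x N ψ)) 0 = a1 at *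
    generalize hb1 : dd eu (dd ev (detVar eu ev x N ψ)) 0 = b1 at *
    generalize hc1 : dd ev (dd ev (detVar eu ev x N ψ)) 0 = c1 at *
    generalize ha2 : dd eu (dd eu (detVar₂ eu ev x N ψ)) 0 = a2 at *
    generalize hb2 : dd eu (dd ev (detVar₂ eu ev x N ψ)) 0 = b2 at *
    generalize hc2 : dd ev (dd ev (detVar₂ eu ev x N ψ)) 0 = c2 at *
    have key := eventually_polynomial_ne_zero (d₀ := a0 * c0 - b0 ^ 2)
      (d₁ := a0 * c1 + a1 * c0 - 2 * b0 * b1)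
      (d₂ := a0 * c2 + a1 * c1 + a2 * c0 - 2 * b0 * b2 - b1 ^ 2)
      (d₃ := a1 * c2 + a2 * c1 - 2 * b1 * b2) (d₄ := a2 * c2 - b2 ^ 2) (by
        rcases hdet with h | ⟨h, h'⟩
        · exact Or.inl h
        · right
          have e1 : a2 = 0 := ha2 ▸ h _ _
          have e2 : b2 = 0 := hb2 ▸ h _ _
          have e3 : c2 = 0 := hc2 ▸ h _ _
          subst e1 e2 e3
          refine ⟨by ring, by ring, ?_⟩
          intro h0; apply h'; linarith)
    filter_upwards [key] with ε hε h0
    apply hε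
    rw [← h0]; ring

theorem perturb_quartic (hx : SmoothNear x 0)
    (h0 : Kbar x 0 = 0) (h1 : dd eu (Kbar x) 0 = 0) (h2 : dd ev (Kbar x) 0 = 0)
    (hN : mixed (dd eu x 0) (dd ev x 0) N ≠ 0)
    (hl : sff eu ev eu eu x 0 ≠ 0 ∨ sff eu ev ev ev x 0 ≠ 0) :
    (∀ ε : ℝ, Kbar (fun q => x q + ε • quartic q • N) 0 = 0 ∧
      dd eu (Kbar (fun q => x q + ε • quartic q • N)) 0 = 0 ∧
      dd ev (Kbar (fun q => x q + ε • quartic q • N)) 0 = 0) ∧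
    ∀ᶠ ε in 𝓝[≠] (0 : ℝ), hessDet eu ev (Kbar (fun q => x q + ε • quartic q • N)) ≠ 0 := by
  have hψ : SmoothNear quartic 0 := ContDiff.smoothNear contDiff_quartic 0
  have hq : ∀ a, SmoothNear (quad a) 0 := fun a => ContDiff.smoothNear (contDiff_quad a) 0
  have hid : SmoothNear (fun p : ℝ × ℝ => p) 0 := smoothNear_id _
  have a1 : dd eu quartic 0 = 0 := by rw [dd_eu_quartic]; simp
  have a2 : dd ev quartic 0 = 0 := by rw [dd_ev_quartic]; simp
  have b1 : ∀ c, dd c (dd eu quartic) 0 = 0 := fun c => by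
    rw [dd_eu_quartic, dd_mul_at hid.fst (hq _), dd_quad_zero, quad_zero]; ring
  have b2 : ∀ c, dd c (dd ev quartic) 0 = 0 := fun c => by
    rw [dd_ev_quartic, dd_mul_at hid.snd (hq _), dd_quad_zero, quad_zero]; ring
  have c1 : ∀ c d, dd c (dd d (dd eu quartic)) 0 = 0 := fun c d => by
    rw [dd_eu_quartic, dd_mul_at₂ hid.fst (hq _), dd_quad_zero, dd_quad_zero, quad_zero]; simp
  have c2 : ∀ c d, dd c (dd d (dd ev quartic)) 0 = 0 := fun c d => by
    rw [dd_ev_quartic, dd_mul_at₂ hid.snd (hq _), dd_quad_zero, dd_quad_zero, quad_zero]; simp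
  have v1 : sffVar eu ev eu eu x N quartic 0 = 0 := sffVar_eq_zero a1 a2 (b1 _)
  have v2 : sffVar eu ev ev ev x N quartic 0 = 0 := sffVar_eq_zero a1 a2 (b2 _)
  have v3 : sffVar eu ev ev eu x N quartic 0 = 0 := sffVar_eq_zero a1 a2 (b1 _)
  have w1 : ∀ c, dd c (sffVar eu ev eu eu x N quartic) 0 = 0 := fun c => by
    rw [dd_sffVar hx hψ a1 a2 (b1 _) (b1 c) (b2 c), c1, zero_mul]
  have w2 : ∀ c, dd c (sffVar eu ev ev ev x N quartic) 0 = 0 := fun c => by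
    rw [dd_sffVar hx hψ a1 a2 (b2 _) (b1 c) (b2 c), c2, zero_mul]
  have w3 : ∀ c, dd c (sffVar eu ev ev eu x N quartic) 0 = 0 := fun c => by
    rw [dd_sffVar hx hψ a1 a2 (b1 _) (b1 c) (b2 c), c1, zero_mul]
  refine perturb_singular hx hψ h0 h1 h2 (detVar_eq_zero v1 v2 v3) (detVar₂_eq_zero v1 v3)
    (fun c => ?_) (dd_detVar₂ hx hψ v1 v2 v3) (Or.inr ⟨fun c d => ?_, ?_⟩)
  · rw [dd_detVar hx hψ v1 v2 v3, w1, w2, w3]; ring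
  · rw [dd_dd_detVar₂ hx hψ v1 v2 v3]; simp only [w1, w2, w3]; ring
  · rw [Kbar_eq_sffDet, sffDet] at h0
    simp only [hessDet, dd_dd_detVar hx hψ v1 v2 v3 w1 w2 w3,
      dd_dd_sffVar hx hψ a1 a2 (b1 _) b1 b2 (fun c => c1 c _) c1 c2,
      dd_dd_sffVar hx hψ a1 a2 (b2 _) b1 b2 (fun c => c2 c _) c1 c2,
      dd_eu_eu_quartic, dd_ev_ev_quartic, dd_ev_eu_quartic, dd_dd_quad _ _ _ 0 rfl]
    simp only [eu, ev] at h0 hl hN ⊢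
    generalize mixed (dd (1, 0) x 0) (dd (0, 1) x 0) N = C at *
    generalize sff (1, 0) (0, 1) (1, 0) (1, 0) x 0 = l at *
    generalize sff (1, 0) (0, 1) (0, 1) (0, 1) x 0 = n at *
    generalize sff (1, 0) (0, 1) (0, 1) (1, 0) x 0 = m at *
    intro h
    have e : 4 * C ^ 2 * (24 * (l ^ 2 + n ^ 2) + 132 * m ^ 2) = 0 := by
      linear_combination h - 4 * C ^ 2 * 148 * h0
    have hpos : 0 < l ^ 2 + n ^ 2 := by
      rcases hl with h | h <;> positivity
    have : 0 < 4 * C ^ 2 * (24 * (l ^ 2 + n ^ 2) + 132 * m ^ 2) := by positivity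
    linarith

theorem perturb_cubic (hx : SmoothNear x 0)
    (h0 : Kbar x 0 = 0) (h1 : dd eu (Kbar x) 0 = 0) (h2 : dd ev (Kbar x) 0 = 0)
    (hN : mixed (dd eu x 0) (dd ev x 0) N ≠ 0)
    (hl : sff eu ev eu eu x 0 = 0) (hn : sff eu ev ev ev x 0 = 0) (hm : sff eu ev ev eu x 0 = 0) :
    (∀ ε : ℝ, Kbar (fun q => x q + ε • cubic q • N) 0 = 0 ∧
      dd eu (Kbar (fun q => x q + ε • cubic q • N)) 0 = 0 ∧
      dd ev (Kbar (fun q => x q + ε • cubic q • N)) 0 = 0) ∧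
    ∀ᶠ ε in 𝓝[≠] (0 : ℝ), hessDet eu ev (Kbar (fun q => x q + ε • cubic q • N)) ≠ 0 := by
  have hψ : SmoothNear cubic 0 := ContDiff.smoothNear contDiff_cubic 0
  have a1 : dd eu cubic 0 = 0 := by rw [dd_eu_cubic, quad_zero]
  have a2 : dd ev cubic 0 = 0 := by rw [dd_ev_cubic, quad_zero]
  have b1 : ∀ c, dd c (dd eu cubic) 0 = 0 := fun c => by rw [dd_eu_cubic, dd_quad_zero]
  have b2 : ∀ c, dd c (dd ev cubic) 0 = 0 := fun c => by rw [dd_ev_cubic, dd_quad_zero]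
  have v1 : sffVar eu ev eu eu x N cubic 0 = 0 := sffVar_eq_zero a1 a2 (b1 _)
  have v2 : sffVar eu ev ev ev x N cubic 0 = 0 := sffVar_eq_zero a1 a2 (b2 _)
  have v3 : sffVar eu ev ev eu x N cubic 0 = 0 := sffVar_eq_zero a1 a2 (b1 _)
  refine perturb_singular hx hψ h0 h1 h2 (detVar_eq_zero v1 v2 v3) (detVar₂_eq_zero v1 v3)
    (fun c => ?_) (dd_detVar₂ hx hψ v1 v2 v3) (Or.inl ?_)
  · rw [dd_detVar hx hψ v1 v2 v3, hl, hm, hn]; ring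
  · simp only [hessDet, dd_dd_detVar₂ hx hψ v1 v2 v3]
    simp only [dd_sffVar hx hψ a1 a2 (b1 _) (b1 _) (b2 _),
      dd_sffVar hx hψ a1 a2 (b2 _) (b1 _) (b2 _), dd_eu_cubic, dd_ev_cubic,
      dd_dd_quad _ _ _ 0 rfl]
    simp only [eu, ev] at hN ⊢
    generalize mixed (dd (1, 0) x 0) (dd (0, 1) x 0) N = C at *
    intro h
    have : C ^ 4 = 0 := by linear_combination -(1 / 1296) * h
    exact hN (pow_eq_zero_iff (by norm_num) |>.1 this)

end Perturbations

end Minkowski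

namespace Minkowski

section JetTopology

variable {A : Type*} [TopologicalSpace A] {E F : Type*} [NormedAddCommGroup E] [NormedSpace ℝ E]
  [NormedAddCommGroup F] [NormedSpace ℝ F]

/-- Iterated directional derivatives. -/
noncomputable def ddList : List E → (E → F) → E → F
  | [], f => f
  | v :: L, f => ddList L (dd v f)

theorem ddList_congr {f g : E → F} {a : E} (h : f =ᶠ[𝓝 a] g) (L : List E) :
    ddList L f a = ddList L g a := by
  induction L generalizing f g with
  | nil => exact h.eq_of_nhds
  | cons v L ih => exact ih (dd_congr h v)

theorem ddList_add {f g : E → F} {a : E} (hf : SmoothNear f a) (hg : SmoothNear g a)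
    (L : List E) : ddList L (fun p => f p + g p) a = ddList L f a + ddList L g a := by
  induction L generalizing f g with
  | nil => rfl
  | cons v L ih =>
    simp only [ddList]
    rw [ddList_congr (dd_add hf hg v), ih (hf.along v) (hg.along v)]

theorem ddList_sub {f g : E → F} {a : E} (hf : SmoothNear f a) (hg : SmoothNear g a)
    (L : List E) : ddList L (fun p => f p - g p) a = ddList L f a - ddList L g a := by
  induction L generalizing f g with
  | nil => rfl
  | cons v L ih =>
    simp only [ddList]
    rw [ddList_congr (dd_sub hf hg v), ih (hf.along v) (hg.along v)]

theorem ddList_apply {f : E → Fin 3 → ℝ} {a : E} (hf : SmoothNear f a) (L : List E) (i : Fin 3) :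
    ddList L (fun p => f p i) a = ddList L f a i := by
  induction L generalizing f with
  | nil => rfl
  | cons v L ih =>
    simp only [ddList]
    have : dd v (fun p => f p i) =ᶠ[𝓝 a] fun p => dd v f p i := by
      filter_upwards [hf] with p hp
      have := hasFDerivAt_pi'.1 (hp.differentiableAt (by simp)).hasFDerivAt i
      simp only [dd, this.fderiv]
      rfl
    rw [ddList_congr this, ih (hf.along v)]

/-- Iterated directional derivatives are values of the iterated derivative. -/
theorem exists_ddList_eq (L : List E) : ∃ (n : ℕ) (m : Fin n → E),
    ∀ {f : E → F} {a : E}, SmoothNear f a → ddList L f a = iteratedFDeriv ℝ n f a m := by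
  induction L with
  | nil => exact ⟨0, ![], fun _ => by simp [ddList]⟩
  | cons v L ih =>
    obtain ⟨n, m, h⟩ := ih
    refine ⟨n + 1, Fin.snoc m v, fun {f a} hf => ?_⟩
    have hd : ContDiffAt ℝ ∞ (fderiv ℝ f) a := hf.contDiffAt.fderiv_right (by simp)
    have e : dd v f = (ContinuousLinearMap.apply ℝ F v) ∘ fderiv ℝ f := rfl
    rw [ddList, h (hf.along v), e, iteratedFDeriv_succ_apply_right,
      ContinuousLinearMap.iteratedFDeriv_comp_left _ hd (mod_cast le_top)]
    simp

/-- A family of smooth germs at the origin all of whose derivatives at the origin are continuous. -/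
def JetContinuous (f : A → E → F) : Prop :=
  (∀ a, SmoothNear (f a) 0) ∧ ∀ L : List E, Continuous fun a => ddList L (f a) 0

theorem JetContinuous.along {f : A → E → F} (hf : JetContinuous f) (v : E) :
    JetContinuous fun a => dd v (f a) :=
  ⟨fun a => (hf.1 a).along v, fun L => hf.2 (v :: L)⟩

theorem JetContinuous.continuous {f : A → E → F} (hf : JetContinuous f) :
    Continuous fun a => f a 0 :=
  hf.2 []

theorem JetContinuous.apply {f : A → E → Fin 3 → ℝ} (hf : JetContinuous f) (i : Fin 3) :
    JetContinuous fun a p => f a p i := by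
  refine ⟨fun a => (hf.1 a).apply i, fun L => ?_⟩
  simp only [fun a => ddList_apply (hf.1 a) L i]
  exact (continuous_apply i).comp (hf.2 L)

theorem JetContinuous.add {f g : A → E → F} (hf : JetContinuous f) (hg : JetContinuous g) :
    JetContinuous fun a p => f a p + g a p := by
  refine ⟨fun a => (hf.1 a).add (hg.1 a), fun L => ?_⟩
  simp only [fun a => ddList_add (hf.1 a) (hg.1 a) L]
  exact (hf.2 L).add (hg.2 L)

theorem JetContinuous.sub {f g : A → E → F} (hf : JetContinuous f) (hg : JetContinuous g) :
    JetContinuous fun a p => f a p - g a p := by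
  refine ⟨fun a => (hf.1 a).sub (hg.1 a), fun L => ?_⟩
  simp only [fun a => ddList_sub (hf.1 a) (hg.1 a) L]
  exact (hf.2 L).sub (hg.2 L)

theorem JetContinuous.mul {f g : A → E → ℝ} (hf : JetContinuous f) (hg : JetContinuous g) :
    JetContinuous fun a p => f a p * g a p := by
  refine ⟨fun a => (hf.1 a).mul (hg.1 a), fun L => ?_⟩
  induction L generalizing f g with
  | nil => exact hf.continuous.mul hg.continuous
  | cons v L ih =>
    have e : ∀ a, ddList (v :: L) (fun p => f a p * g a p) 0 =
        ddList L (fun p => dd v (f a) p * g a p) 0 +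
          ddList L (fun p => f a p * dd v (g a) p) 0 := by
      intro a
      simp only [ddList]
      rw [ddList_congr (dd_mul (hf.1 a) (hg.1 a) v),
        ddList_add (((hf.1 a).along v).mul (hg.1 a)) ((hf.1 a).mul ((hg.1 a).along v))]
    simp only [e]
    exact (ih (hf.along v) hg).add (ih hf (hg.along v))

theorem JetContinuous.mixed {f g h : A → E → Fin 3 → ℝ} (hf : JetContinuous f)
    (hg : JetContinuous g) (hh : JetContinuous h) :
    JetContinuous fun a p => Minkowski.mixed (f a p) (g a p) (h a p) := by
  simp only [mixed_eq]
  exact (((((hf.apply 1).mul (hg.apply 2)).sub ((hf.apply 2).mul (hg.apply 1))).mul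
    (hh.apply 0)).add ((((hf.apply 2).mul (hg.apply 0)).sub ((hf.apply 0).mul (hg.apply 2))).mul
    (hh.apply 1))).add ((((hf.apply 0).mul (hg.apply 1)).sub ((hf.apply 1).mul (hg.apply 0))).mul
    (hh.apply 2))

theorem JetContinuous.sffDet {X : A → E → Fin 3 → ℝ} (hX : JetContinuous X) (e₁ e₂ : E) :
    JetContinuous fun a => sffDet e₁ e₂ (X a) := by
  have s : ∀ v w, JetContinuous fun a => sff e₁ e₂ v w (X a) := fun v w =>
    (hX.along e₁).mixed (hX.along e₂) ((hX.along w).along v)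
  have := ((s e₁ e₁).mul (s e₂ e₂)).sub ((s e₂ e₁).mul (s e₂ e₁))
  convert this using 3
  simp only [Minkowski.sffDet]
  ring

theorem jetContinuous_of_iteratedFDeriv {f : A → E → F} (hs : ∀ a, SmoothNear (f a) 0)
    (hc : ∀ k, Continuous fun a => iteratedFDeriv ℝ k (f a) 0) : JetContinuous f := by
  refine ⟨hs, fun L => ?_⟩
  obtain ⟨n, m, h⟩ := exists_ddList_eq (F := F) L
  simp only [fun a => h (hs a)]
  exact (continuous_eval_const m).comp (hc n)

theorem continuous_iteratedFDeriv_perturb {f φ : E → F} (hf : SmoothNear f 0)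
    (hφ : SmoothNear φ 0) :
    Continuous fun (ε : ℝ) (k : ℕ) => iteratedFDeriv ℝ k (fun p => f p + ε • φ p) 0 := by
  refine continuous_pi fun k => ?_
  have h1 : ContDiffAt ℝ k f 0 := hf.contDiffAt.of_le (mod_cast le_top)
  have h2 : ContDiffAt ℝ k φ 0 := hφ.contDiffAt.of_le (mod_cast le_top)
  have e : ∀ ε : ℝ, iteratedFDeriv ℝ k (fun p => f p + ε • φ p) 0 =
      iteratedFDeriv ℝ k f 0 + ε • iteratedFDeriv ℝ k φ 0 := by
    intro ε
    rw [← iteratedFDeriv_const_smul_apply h2]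
    exact iteratedFDeriv_add_apply h1 (h2.const_smul ε)
  simp only [e]
  fun_prop

theorem jetContinuous_paramGerm : JetContinuous fun x : ParamGerm => x.toFun :=
  jetContinuous_of_iteratedFDeriv (fun x => x.smooth) <| continuous_pi_iff.1 <|
    continuous_induced_dom (f := fun (x : ParamGerm) (k : ℕ) => iteratedFDeriv ℝ k x.toFun 0)

theorem jetContinuous_surfaceFamily (x : ParamGerm) :
    JetContinuous fun X : SurfaceFamily x => X.toFun :=
  jetContinuous_of_iteratedFDeriv (fun X => X.smooth) <| continuous_pi_iff.1 <|
    continuous_induced_dom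
      (f := fun (X : SurfaceFamily x) (k : ℕ) => iteratedFDeriv ℝ k X.toFun 0)

theorem genericIn_of_inter_eq {T : Type*} [TopologicalSpace T] {Y P U : Set T} (hU : IsOpen U)
    (h : ∀ y ∈ Y, y ∈ P ↔ y ∈ U) (hd : ∀ y ∈ Y, y ∈ closure (Y ∩ U)) : GenericIn Y P := by
  have e : ((↑) : Y → T) ⁻¹' P = ((↑) : Y → T) ⁻¹' U := by
    ext ⟨y, hy⟩; exact h y hy
  refine ⟨e ▸ hU.preimage continuous_subtype_val, ?_⟩
  rw [e, Subtype.dense_iff, Subtype.image_preimage_coe]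
  exact hd

end JetTopology

section Families

/-- The parabolic curve is singular at the origin. -/
def SingularAt (f : ℝ × ℝ → ℝ) : Prop := f 0 = 0 ∧ dd eu f 0 = 0 ∧ dd ev f 0 = 0

theorem isSingularPC_iff (x : ℝ × ℝ → Fin 3 → ℝ) : IsSingularPC x 0 ↔ SingularAt (Kbar x) := by
  rw [IsSingularPC, fderiv_plane_eq_zero_iff, SingularAt]

theorem SurfaceFamily.Kbar_eventuallyEq {x : ParamGerm} (X : SurfaceFamily x) :
    X.Kbar =ᶠ[𝓝 0] sffDet (eu, 0) (ev, 0) X.toFun := by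
  filter_upwards [X.smooth.eventually_smoothNear] with q hq
  exact sffDet_slice hq

theorem SurfaceFamily.Kbar_slice {x : ParamGerm} (X : SurfaceFamily x) :
    (fun p => X.Kbar (p, 0)) =ᶠ[𝓝 0] Minkowski.Kbar x.toFun :=
  sffDet_congr X.initial eu ev

theorem isRVersal_Kbar_iff {x : ParamGerm} (hx : SingularAt (Kbar x.toFun))
    (hdet : hessDet eu ev (Kbar x.toFun) ≠ 0) (X : SurfaceFamily x) :
    IsRVersal X.Kbar ↔ dd (0, 1) (sffDet (eu, 0) (ev, 0) X.toFun) 0 ≠ 0 := by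
  have hK : SmoothNear X.Kbar 0 := (X.smooth.sffDet _ _).congr X.Kbar_eventuallyEq
  have hd : ∀ w : ℝ × ℝ, dd (w, 0) X.Kbar 0 = dd w (Kbar x.toFun) 0 := fun w =>
    (dd_slice (K := X.Kbar) (p := 0) (t := 0) hK.differentiableAt w).symm.trans
      (dd_congr_at X.Kbar_slice w)
  have h1 := (hd eu).trans hx.2.1
  have h2 := (hd ev).trans hx.2.2
  rw [← dd_congr_at X.Kbar_eventuallyEq]
  refine ⟨fun h => h.dd_ne_zero h1 h2, isRVersal_of_dd_ne_zero hK ?_ h1 h2 ?_⟩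
  · exact X.Kbar_slice.eq_of_nhds.trans hx.1
  · rwa [← hessDet_slice hK, hessDet_congr X.Kbar_slice]

/-- The function `t (u² + v²)`. -/
def bump (q : (ℝ × ℝ) × ℝ) : ℝ := q.2 * quad (1, 0, 1) q.1

theorem contDiff_bump : ContDiff ℝ ∞ bump := by unfold bump quad; fun_prop

/-- The family obtained from `X` by moving `M_t` by `ε t (u² + v²) N`. -/
def SurfaceFamily.perturb {x : ParamGerm} (X : SurfaceFamily x) (N : Fin 3 → ℝ) (ε : ℝ) :
    SurfaceFamily x where
  toFun q := X.toFun q + ε • bump q • N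
  smooth := X.smooth.add ((ContDiff.smoothNear contDiff_bump 0).smul_smul_const N ε)
  initial := by
    filter_upwards [X.initial] with p hp
    simp [hp, bump]

theorem SurfaceFamily.continuous_perturb {x : ParamGerm} (X : SurfaceFamily x) (N : Fin 3 → ℝ) :
    Continuous (X.perturb N) :=
  continuous_induced_rng.2 (continuous_iteratedFDeriv_perturb X.smooth
    ((ContDiff.smoothNear contDiff_bump 0).smul (smoothNear_const N 0)))

theorem SurfaceFamily.perturb_zero {x : ParamGerm} (X : SurfaceFamily x) (N : Fin 3 → ℝ) :
    X.perturb N 0 = X := by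
  cases X; simp [SurfaceFamily.perturb]

theorem dd_id {E : Type*} [NormedAddCommGroup E] [NormedSpace ℝ E] (v p : E) :
    dd v (fun q => q) p = v := by
  simp [dd]

theorem dd_bump (v : ℝ × ℝ) (q : (ℝ × ℝ) × ℝ) :
    dd (v, 0) bump q = q.2 * (2 * (v.1 * q.1.1 + v.2 * q.1.2)) := by
  have h := dd_slice (K := bump) (p := q.1) (t := q.2)
    (contDiff_bump.differentiable (by simp) _) v
  rw [← h]
  have hid : SmoothNear (fun p : ℝ × ℝ => p) q.1 := smoothNear_id _
  have e : (fun p => bump (p, q.2)) = fun p : ℝ × ℝ => q.2 * (p.1 * p.1 + p.2 * p.2) := by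
    funext p; simp only [bump, quad]; ring
  have s := (hid.fst.mul hid.fst).add (hid.snd.mul hid.snd)
  rw [e, dd_mul_at (smoothNear_const _ _) s, dd_const,
    dd_add_at (hid.fst.mul hid.fst) (hid.snd.mul hid.snd), dd_mul_at hid.fst hid.fst,
    dd_mul_at hid.snd hid.snd, dd_fst hid, dd_snd hid, dd_id]
  ring

theorem dd_dd_bump (v w : ℝ × ℝ) (q : (ℝ × ℝ) × ℝ) :
    dd (v, 0) (dd (w, 0) bump) q = q.2 * (2 * (v.1 * w.1 + v.2 * w.2)) := by
  have s1 : SmoothNear (fun p : ℝ × ℝ => w.1 * p.1) q.1 :=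
    (smoothNear_const _ _).mul (smoothNear_id _).fst
  have s2 : SmoothNear (fun p : ℝ × ℝ => w.2 * p.2) q.1 :=
    (smoothNear_const _ _).mul (smoothNear_id _).snd
  have hid : SmoothNear (fun p : ℝ × ℝ => p) q.1 := smoothNear_id _
  have e : dd (w, 0) bump = fun q => q.2 * (2 * (w.1 * q.1.1 + w.2 * q.1.2)) :=
    funext fun q => dd_bump w q
  rw [e]
  have h := dd_slice (K := fun q : (ℝ × ℝ) × ℝ => q.2 * (2 * (w.1 * q.1.1 + w.2 * q.1.2)))
    (p := q.1) (t := q.2) (by fun_prop) v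
  rw [← h]
  rw [dd_mul_at (smoothNear_const _ _) ((smoothNear_const _ _).mul (s1.add s2)), dd_const,
    dd_mul_at (smoothNear_const _ _) (s1.add s2), dd_const, dd_add_at s1 s2,
    dd_mul_at (smoothNear_const _ _) hid.fst, dd_mul_at (smoothNear_const _ _) hid.snd, dd_const,
    dd_const, dd_fst hid, dd_snd hid, dd_id]
  ring

theorem dd_snd_mul {g : (ℝ × ℝ) × ℝ → ℝ} (hg : SmoothNear g 0) :
    dd (0, 1) (fun q : (ℝ × ℝ) × ℝ => q.2 * g q) 0 = g 0 := by
  have hid : SmoothNear (fun q : (ℝ × ℝ) × ℝ => q) 0 := smoothNear_id _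
  have : dd (0, 1) (fun q : (ℝ × ℝ) × ℝ => q.2) 0 = (1 : ℝ) := by
    simp only [dd]
    rw [(hid.differentiableAt.hasFDerivAt.snd).fderiv]
    simp
  rw [dd_mul_at hid.snd hg, this]
  simp

theorem dd_sffDet_perturb {x : ParamGerm} (X : SurfaceFamily x) (N : Fin 3 → ℝ) (ε : ℝ) :
    dd (0, 1) (sffDet (eu, 0) (ev, 0) (X.perturb N ε).toFun) 0 =
      dd (0, 1) (sffDet (eu, 0) (ev, 0) X.toFun) 0 +
      ε * (2 * (sff eu ev eu eu x.toFun 0 + sff eu ev ev ev x.toFun 0) *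
        mixed (dd eu x.toFun 0) (dd ev x.toFun 0) N) := by
  have hX := X.smooth
  have hψ : SmoothNear bump 0 := ContDiff.smoothNear contDiff_bump 0
  have a1 : ∀ v : ℝ × ℝ, dd (v, 0) bump 0 = 0 := fun v => by rw [dd_bump]; simp
  have a2 : ∀ v w : ℝ × ℝ, dd (v, 0) (dd (w, 0) bump) 0 = 0 := fun v w => by
    rw [dd_dd_bump]; simp
  have b1 : ∀ v : ℝ × ℝ, dd (0, 1) (dd (v, 0) bump) 0 = 0 := fun v => by
    rw [show dd (v, 0) bump = _ from funext fun q => dd_bump v q,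
      dd_snd_mul (ContDiff.smoothNear (by fun_prop) 0)]
    simp
  have b2 : ∀ v w : ℝ × ℝ, dd (0, 1) (dd (v, 0) (dd (w, 0) bump)) 0 =
      2 * (v.1 * w.1 + v.2 * w.2) := fun v w => by
    rw [show dd (v, 0) (dd (w, 0) bump) = _ from funext fun q => dd_dd_bump v w q,
      dd_snd_mul (smoothNear_const _ _)]
  have v0 : ∀ v w : ℝ × ℝ, sffVar (eu, 0) (ev, 0) (v, 0) (w, 0) X.toFun N bump 0 = 0 :=
    fun v w => sffVar_eq_zero (a1 _) (a1 _) (a2 _ _)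
  have v1 : ∀ v w : ℝ × ℝ, dd (0, 1) (sffVar (eu, 0) (ev, 0) (v, 0) (w, 0) X.toFun N bump) 0 =
      2 * (v.1 * w.1 + v.2 * w.2) * mixed (dd (eu, 0) X.toFun 0) (dd (ev, 0) X.toFun 0) N :=
    fun v w => by rw [dd_sffVar hX hψ (a1 _) (a1 _) (a2 _ _) (b1 _) (b1 _), b2]
  have hslice : (fun p => X.toFun (p, 0)) =ᶠ[𝓝 0] x.toFun := X.initial
  have hX0 : SmoothNear X.toFun ((0 : ℝ × ℝ), (0 : ℝ)) := hX
  have d1 : ∀ v : ℝ × ℝ, dd (v, 0) X.toFun 0 = dd v x.toFun 0 := fun v =>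
    (dd_slice (K := X.toFun) hX0.differentiableAt v).symm.trans (dd_congr_at hslice v)
  have d2 : ∀ v w : ℝ × ℝ, dd (v, 0) (dd (w, 0) X.toFun) 0 = dd v (dd w x.toFun) 0 := fun v w =>
    (dd_dd_slice hX0 v w).symm.trans (dd_congr_at₂ hslice v w)
  have s : ∀ v w : ℝ × ℝ, sff (eu, 0) (ev, 0) (v, 0) (w, 0) X.toFun 0 =
      sff eu ev v w x.toFun 0 := fun v w => by simp only [sff, d1, d2]
  have t1 := hX.detVar hψ N (eu, 0) (ev, 0)
  have t2 := hX.detVar₂ hψ N (eu, 0) (ev, 0)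
  have c1 := (smoothNear_const ε (0 : (ℝ × ℝ) × ℝ)).mul t1
  have c2 := (smoothNear_const (ε ^ 2) (0 : (ℝ × ℝ) × ℝ)).mul t2
  have hexp : sffDet (eu, 0) (ev, 0) (X.perturb N ε).toFun =ᶠ[𝓝 0] _ :=
    sffDet_perturb hX hψ N ε (eu, 0) (ev, 0)
  rw [dd_congr_at hexp, dd_add_at (hX.sffDet _ _) (c1.add c2), dd_add_at c1 c2,
    dd_mul_at (smoothNear_const _ _) t1, dd_mul_at (smoothNear_const _ _) t2, dd_const, dd_const,
    dd_detVar hX hψ (v0 _ _) (v0 _ _) (v0 _ _), dd_detVar₂ hX hψ (v0 _ _) (v0 _ _) (v0 _ _),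
    v1, v1, v1, s, s, s, d1, d1]
  simp only [eu, ev]
  ring

theorem genericIn_isRVersal {x : ParamGerm} (hx : SingularAt (Kbar x.toFun))
    (hdet : hessDet eu ev (Kbar x.toFun) ≠ 0) (hflat : ¬ IsFlatUmbilic x.toFun 0) :
    GenericIn (univ : Set (SurfaceFamily x)) {X | IsRVersal X.Kbar} := by
  obtain ⟨N, hN⟩ := exists_mixed_ne_zero x.immersion
  change mixed (dd eu x.toFun 0) (dd ev x.toFun 0) N ≠ 0 at hN
  have hcont : Continuous fun X : SurfaceFamily x =>
      dd (0, 1) (sffDet (eu, 0) (ev, 0) X.toFun) 0 :=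
    (((jetContinuous_surfaceFamily x).sffDet (eu, 0) (ev, 0)).along (0, 1)).continuous
  refine genericIn_of_inter_eq
    (U := {X | dd (0, 1) (sffDet (eu, 0) (ev, 0) X.toFun) 0 ≠ 0})
    (isOpen_ne_fun hcont continuous_const) (fun X _ => isRVersal_Kbar_iff hx hdet X)
    (fun X _ => ?_)
  have hln : sff eu ev eu eu x.toFun 0 + sff eu ev ev ev x.toFun 0 ≠ 0 := by
    intro h
    have hK := hx.1
    rw [Kbar_eq_sffDet, sffDet] at hK
    apply hflat
    have hl : sff eu ev eu eu x.toFun 0 = 0 := by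
      have : sff eu ev ev ev x.toFun 0 = - sff eu ev eu eu x.toFun 0 := by linarith
      rw [this] at hK
      nlinarith [sq_nonneg (sff eu ev eu eu x.toFun 0), sq_nonneg (sff eu ev ev eu x.toFun 0)]
    have hn : sff eu ev ev ev x.toFun 0 = 0 := by linarith
    have hm : sff eu ev ev eu x.toFun 0 = 0 := by
      rw [hl, hn] at hK
      nlinarith [sq_nonneg (sff eu ev ev eu x.toFun 0)]
    exact ⟨⟨0, by rw [zero_mul]; exact hl, by rw [zero_mul]; exact hm,
      by rw [zero_mul]; exact hn⟩, hx.1⟩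
  have ht : Tendsto (X.perturb N) (𝓝[≠] 0) (𝓝 X) := by
    have := (X.continuous_perturb N).continuousAt (x := 0)
    rw [ContinuousAt, X.perturb_zero] at this
    exact this.mono_left nhdsWithin_le_nhds
  refine mem_closure_of_tendsto ht ?_
  set c := 2 * (sff eu ev eu eu x.toFun 0 + sff eu ev ev ev x.toFun 0) *
    mixed (dd eu x.toFun 0) (dd ev x.toFun 0) N with hc
  have hc0 : c ≠ 0 := mul_ne_zero (mul_ne_zero two_ne_zero hln) hN
  set d := dd (0, 1) (sffDet (eu, 0) (ev, 0) X.toFun) 0 with hd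
  have hne : ∀ᶠ ε in 𝓝[≠] (0 : ℝ), d + ε * c ≠ 0 := by
    have hfin : {ε : ℝ | d + ε * c = 0}.Finite :=
      Set.Subsingleton.finite fun a ha b hb =>
        mul_right_cancel₀ hc0 (add_left_cancel (ha.trans hb.symm))
    exact nhdsNE_le_cofinite (0 : ℝ) hfin.compl_mem_cofinite
  filter_upwards [hne] with ε hε
  refine ⟨mem_univ _, ?_⟩
  rw [mem_ofPred_eq, dd_sffDet_perturb]
  exact hε

end Families

section Germs

theorem Kbar_reparam {x y : ParamGerm} {h : ℝ × ℝ → ℝ × ℝ} (hh : IsDiffeoGerm h)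
    (he : ∀ᶠ p in 𝓝 (0 : ℝ × ℝ), y.toFun (h p) = x.toFun p) :
    Kbar x.toFun =ᶠ[𝓝 0] fun p => jac h p ^ 4 * Kbar y.toFun (h p) := by
  have he' : x.toFun =ᶠ[𝓝 0] fun p => y.toFun (h p) := he.mono fun _ hp => hp.symm
  refine (sffDet_congr he' eu ev).trans ?_
  filter_upwards [(hh.2.1.tendsto hh.1).eventually y.smooth.eventually_smoothNear,
    hh.2.1.eventually_smoothNear] with p h1 h2
  exact Kbar_comp h1 h2

theorem singularAt_reparam {x y : ParamGerm} (hxy : REquiv x.toFun y.toFun)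
    (hy : SingularAt (Kbar y.toFun)) : SingularAt (Kbar x.toFun) ∧
      (hessDet eu ev (Kbar y.toFun) ≠ 0 → hessDet eu ev (Kbar x.toFun) ≠ 0) := by
  obtain ⟨h, hh, he⟩ := hxy
  have hK := Kbar_reparam hh he
  have hs : SmoothNear (Kbar y.toFun) 0 := y.smooth.sffDet eu ev
  have hsh : SmoothNear (fun p => Kbar y.toFun (h p)) 0 := hs.comp_of_eq hh.2.1 hh.1
  have hj : SmoothNear (fun p => jac h p ^ 4) 0 := hh.2.1.jacobian.pow 4
  have h0 : Kbar y.toFun (h 0) = 0 := by rw [hh.1]; exact hy.1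
  have hd : ∀ v, dd v (fun p => Kbar y.toFun (h p)) 0 = 0 :=
    dd_comp_eq_zero hs hh.2.1 hh.1 hy.2.1 hy.2.2
  have hd' : ∀ v, dd v (Kbar x.toFun) 0 = 0 := fun v => by
    rw [dd_congr_at hK, dd_mul_at hj hsh, hd, h0]; simp
  refine ⟨⟨by rw [hK.eq_of_nhds, h0, mul_zero], hd' _, hd' _⟩, fun hne => ?_⟩
  rw [hessDet_congr hK, hessDet_mul hj hsh h0 (hd _) (hd _),
    hessDet_comp hs hh.2.1 hh.1 hy.2.1 hy.2.2]
  have := hh.jac_ne_zero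
  positivity

theorem parametrizes_iff {x y : ParamGerm} :
    Parametrizes x (Quotient.mk ParamGerm.rSetoid y) ↔ REquiv x.toFun y.toFun :=
  Quotient.eq (r := ParamGerm.rSetoid)

/-- The germ obtained from `x` by a move `ε ψ N` with `ψ` vanishing to first order. -/
def ParamGerm.perturb (x : ParamGerm) {ψ : ℝ × ℝ → ℝ} (hψ : ContDiff ℝ ∞ ψ)
    (hd : ∀ v, dd v ψ 0 = 0) (N : Fin 3 → ℝ) (ε : ℝ) : ParamGerm where
  toFun q := x.toFun q + ε • ψ q • N
  smooth := x.smooth.add ((ContDiff.smoothNear hψ 0).smul_smul_const N ε)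
  immersion := by
    have : fderiv ℝ (fun q => x.toFun q + ε • ψ q • N) 0 = fderiv ℝ x.toFun 0 := by
      refine ContinuousLinearMap.ext fun v => ?_
      have := dd_perturb x.smooth (ContDiff.smoothNear hψ 0) N ε v
      rw [hd] at this
      simpa [dd] using this
    rw [this]; exact x.immersion

variable {x : ParamGerm} {ψ : ℝ × ℝ → ℝ} {hψ : ContDiff ℝ ∞ ψ} {hd : ∀ v, dd v ψ 0 = 0}
  {N : Fin 3 → ℝ}

theorem ParamGerm.continuous_perturb : Continuous (x.perturb hψ hd N) :=
  continuous_induced_rng.2 (continuous_iteratedFDeriv_perturb x.smooth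
    ((ContDiff.smoothNear hψ 0).smul (smoothNear_const N 0)))

theorem ParamGerm.perturb_zero : x.perturb hψ hd N 0 = x := by
  cases x; simp [ParamGerm.perturb]

theorem ParamGerm.delta_perturb (ε : ℝ) : delta (x.perturb hψ hd N ε).toFun 0 = delta x.toFun 0 := by
  have : ∀ v, dd v (x.perturb hψ hd N ε).toFun 0 = dd v x.toFun 0 := fun v => by
    have := dd_perturb x.smooth (ContDiff.smoothNear hψ 0) N ε v
    rw [hd] at this
    simpa [ParamGerm.perturb] using this
  have h1 : pu (x.perturb hψ hd N ε).toFun 0 = pu x.toFun 0 := this eu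
  have h2 : pv (x.perturb hψ hd N ε).toFun 0 = pv x.toFun 0 := this ev
  simp only [delta, coeffE, coeffF, coeffG, h1, h2]

/-- The germs which are not degenerate singular points of the parabolic curve. -/
def nondegenerateGerms : Set SurfaceGerm :=
  {S | ∀ x : ParamGerm, Parametrizes x S → SingularAt (Kbar x.toFun) →
    hessDet eu ev (Kbar x.toFun) ≠ 0}

theorem mk_mem_nondegenerateGerms (x : ParamGerm) :
    Quotient.mk ParamGerm.rSetoid x ∈ nondegenerateGerms ↔
      (SingularAt (Kbar x.toFun) → hessDet eu ev (Kbar x.toFun) ≠ 0) := by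
  refine ⟨fun h => h x rfl, fun h y hy hs => ?_⟩
  have hyx := parametrizes_iff.1 hy
  have hx := (singularAt_reparam hyx.symm hs).1
  exact (singularAt_reparam hyx hx).2 (h hx)

theorem isOpen_nondegenerateGerms : IsOpen nondegenerateGerms := by
  have hq : IsQuotientMap (Quotient.mk ParamGerm.rSetoid) := isQuotientMap_quotient_mk'
  rw [← hq.isOpen_preimage]
  have hK := jetContinuous_paramGerm.sffDet eu ev
  have e : Quotient.mk ParamGerm.rSetoid ⁻¹' nondegenerateGerms =
      {x : ParamGerm | sffDet eu ev x.toFun 0 ≠ 0} ∪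
      {x : ParamGerm | dd eu (sffDet eu ev x.toFun) 0 ≠ 0} ∪
      {x : ParamGerm | dd ev (sffDet eu ev x.toFun) 0 ≠ 0} ∪
      {x : ParamGerm | hessDet eu ev (sffDet eu ev x.toFun) ≠ 0} := by
    ext x
    rw [mem_preimage, mk_mem_nondegenerateGerms]
    simp only [SingularAt, Kbar_eq_sffDet, mem_union, mem_ofPred_eq]
    tauto
  rw [e]
  refine ((IsOpen.union ?_ ?_).union ?_).union ?_
  · exact isOpen_ne_fun hK.continuous continuous_const
  · exact isOpen_ne_fun (hK.along eu).continuous continuous_const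
  · exact isOpen_ne_fun (hK.along ev).continuous continuous_const
  · refine isOpen_ne_fun ?_ continuous_const
    exact (((hK.along eu).along eu).continuous.mul ((hK.along ev).along ev).continuous).sub
      (((hK.along ev).along eu).continuous.pow 2)

theorem mem_closure_of_perturb (hx : 0 < delta x.toFun 0)
    (h : (∀ ε : ℝ, SingularAt (Kbar (fun q => x.toFun q + ε • ψ q • N))) ∧
      ∀ᶠ ε in 𝓝[≠] (0 : ℝ), hessDet eu ev (Kbar (fun q => x.toFun q + ε • ψ q • N)) ≠ 0)
    (hψ : ContDiff ℝ ∞ ψ) (hd : ∀ v, dd v ψ 0 = 0) :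
    Quotient.mk ParamGerm.rSetoid x ∈ closure (singularPCGerms ∩ nondegenerateGerms) := by
  have hq : IsQuotientMap (Quotient.mk ParamGerm.rSetoid) := isQuotientMap_quotient_mk'
  have hc : Continuous fun ε => Quotient.mk ParamGerm.rSetoid (x.perturb hψ hd N ε) :=
    hq.continuous.comp ParamGerm.continuous_perturb
  have ht : Tendsto (fun ε => Quotient.mk ParamGerm.rSetoid (x.perturb hψ hd N ε)) (𝓝[≠] 0)
      (𝓝 (Quotient.mk ParamGerm.rSetoid x)) := by
    have := hc.continuousAt (x := 0)
    rw [ContinuousAt, ParamGerm.perturb_zero] at this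
    exact this.mono_left nhdsWithin_le_nhds
  refine mem_closure_of_tendsto ht ?_
  filter_upwards [h.2] with ε hε
  refine ⟨⟨x.perturb hψ hd N ε, rfl, ?_, (isSingularPC_iff _).2 (h.1 ε)⟩, ?_⟩
  · rwa [ParamGerm.delta_perturb]
  · exact (mk_mem_nondegenerateGerms _).2 fun _ => hε

theorem mem_closure_nondegenerateGerms (hx : 0 < delta x.toFun 0)
    (hs : SingularAt (Kbar x.toFun)) :
    Quotient.mk ParamGerm.rSetoid x ∈ closure (singularPCGerms ∩ nondegenerateGerms) := by
  obtain ⟨N, hN⟩ := exists_mixed_ne_zero x.immersion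
  by_cases hl : sff eu ev eu eu x.toFun 0 ≠ 0 ∨ sff eu ev ev ev x.toFun 0 ≠ 0
  · refine mem_closure_of_perturb hx (perturb_quartic x.smooth hs.1 hs.2.1 hs.2.2 hN hl)
      contDiff_quartic fun v => ?_
    refine (fderiv_plane quartic 0 v).trans ?_
    rw [dd_eu_quartic, dd_ev_quartic]; simp
  · push Not at hl
    have hm : sff eu ev ev eu x.toFun 0 = 0 := by
      have := hs.1
      rw [Kbar_eq_sffDet, sffDet, hl.1, zero_mul, zero_sub, neg_eq_zero] at this
      exact pow_eq_zero_iff (two_ne_zero) |>.1 this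
    refine mem_closure_of_perturb hx
      (perturb_cubic x.smooth hs.1 hs.2.1 hs.2.2 hN hl.1 hl.2 hm) contDiff_cubic fun v => ?_
    refine (fderiv_plane cubic 0 v).trans ?_
    rw [dd_eu_cubic, dd_ev_cubic, quad_zero, quad_zero]; simp

end Germs

end Minkowski

theorem mainTheorem8 :
    GenericIn singularPCGerms
      {S : SurfaceGerm | ∀ x : ParamGerm, Parametrizes x S →
        HasA1 (Kbar x.toFun) ∧
        (¬ IsFlatUmbilic x.toFun 0 →
          GenericIn (univ : Set (SurfaceFamily x)) {X | IsRVersal X.Kbar})} := by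
  refine genericIn_of_inter_eq isOpen_nondegenerateGerms ?_ ?_
  · rintro _ ⟨x₀, rfl, -, h₀⟩
    rw [isSingularPC_iff] at h₀
    constructor
    · intro h x hx _
      exact (h x hx).1.hessDet_ne_zero
    · intro h x hx
      have hs := (singularAt_reparam (parametrizes_iff.1 hx) h₀).1
      have hdet := h x hx hs
      exact ⟨hasA1_of_hessDet_ne_zero (x.smooth.sffDet eu ev) hs.1 hs.2.1 hs.2.2 hdet,
        genericIn_isRVersal hs hdet⟩
  · rintro _ ⟨x, rfl, hδ, h₀⟩
    exact mem_closure_nondegenerateGerms hδ ((isSingularPC_iff _).1 h₀)
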